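/- Let $S^1=\mathbb{R}/\mathbb{Z}$ be the circle of unit circumference, and for $x,y\in S^1$ let $\vec d(x,y)\in[0,1)$ be the clockwise distance from $x$ to $y$. For a finite set $X\subseteq S^1$ and $0<r\le 1$, let $f_r\colon X\to X$ send $x$ to the clockwise furthest element of $X$ in the arc $[x,x+r)_{S^1}$, that is, to the $y\in X$ with $\vec d(x,y)<r$ that maximizes $\vec d(x,y)$. A point $x\in X$ is periodic if $f_r^m(x)=x$ for some $m\ge 1$. A non-periodic point $x$ is at level $i\ge 0$ if $x\in f_r^i(X)\setminus f_r^{i+1}(X)$, where $f_r^0=\mathrm{id}_X$; let $\mathrm{lev}_i(X,r)$ be the number of non-periodic points at level $i$. Let $C_i=\frac{1}{i+1}\binom{2i}{i}$ be the $i$-th Catalan number and, for an integer $h\ge -1$, let $C_{i,h}$ be the number of lattice paths starting at $(0,0)$ with $i$ up-steps $(1,1)$ and $i$ down-steps $(1,-1)$ such that $0\le y\le h$ for all points $(x,y)$ on the path (in particular $C_{i,-1}=0$ for all $i\geq 0$). **Theorem.** Let $0<r\le 1$ and let $i\ge 0$ be an integer. For each $n$ let $X_n$ be a set of $n$ points chosen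 independently and uniformly at random from $S^1$. Then $$\lim_{n\to\infty}\frac{\mathbf{E}[\mathrm{lev}_i(X_n,r)]}{n}=\begin{cases}\dfrac{C_i}{2^{2i+1}} & \text{if } r \text{ is irrational},\\[2ex] \dfrac{C_{i,q-2}}{2^{2i+1}} & \text{if } r=\dfrac{p}{q}\text{ with } p,q \text{ coprime positive integers}.\end{cases}$$ -/

import Mathlib

open MeasureTheory ProbabilityTheory Filter Topology

noncomputable section

/-- The clockwise distance from `x` to `y` on the circle `ℝ/ℤ` of unit circumference (the positive
direction is the clockwise one): the representative of `y - x` in `[0, 1)`. -/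
def cwDist (x y : UnitAddCircle) : ℝ :=
  (AddCircle.equivIco 1 0 (y - x) : ℝ)

theorem cwDist_self (x : UnitAddCircle) : cwDist x x = 0 := by
  have h := AddCircle.coe_equivIco_mk_apply (p := (1 : ℝ)) 0
  simpa [cwDist] using h

theorem exists_cyclicMap (X : Finset UnitAddCircle) (r : ℝ) (hr : 0 < r) (x : X) :
    ∃ y : X, cwDist x y < r ∧ ∀ z : X, cwDist x z < r → cwDist x z ≤ cwDist x y := by
  classical
  obtain ⟨y, hy, hmax⟩ := Finset.exists_max_image
    (Finset.univ.filter fun y : X => cwDist x y < r) (fun y : X => cwDist x y)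
    ⟨x, by simp [cwDist_self, hr]⟩
  exact ⟨y, by simpa using hy, fun z hz => hmax z (by simpa using hz)⟩

/-- The map `f_r : X → X` on a finite subset `X` of the circle: `f_r x` is the clockwise furthest
element of `X` in the half-open clockwise arc `[x, x + r)`. -/
def cyclicMap (X : Finset UnitAddCircle) (r : ℝ) (hr : 0 < r) (x : X) : X :=
  (exists_cyclicMap X r hr x).choose

theorem cyclicMap_spec (X : Finset UnitAddCircle) (r : ℝ) (hr : 0 < r) (x : X) :
    cwDist x (cyclicMap X r hr x) < r ∧
      ∀ z : X, cwDist x z < r → cwDist x z ≤ cwDist x (cyclicMap X r hr x) :=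
  (exists_cyclicMap X r hr x).choose_spec

/-- The number of non-periodic points `x` of `f_r : X → X` at level `i`, i.e. such that
`x ∈ f_r^i(X) \ f_r^{i+1}(X)`. -/
def lev (i : ℕ) (X : Finset UnitAddCircle) (r : ℝ) (hr : 0 < r) : ℕ :=
  Set.ncard {x : X | x ∉ Function.periodicPts (cyclicMap X r hr) ∧
    x ∈ Set.range (cyclicMap X r hr)^[i] \ Set.range (cyclicMap X r hr)^[i + 1]}

/-- The finite subset of the circle formed by `n` sample points. -/
def sampleSet {n : ℕ} (x : Fin n → UnitAddCircle) : Finset UnitAddCircle :=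
  open Classical in Finset.univ.image x

/-- The height of a Dyck path after its first `k` steps. -/
def dyckHeight (w : DyckWord) (k : ℕ) : ℤ :=
  ((w.toList.take k).count DyckStep.U : ℤ) - ((w.toList.take k).count DyckStep.D : ℤ)

/-- The number `C_{i,h}` of Dyck paths with `i` up-steps and `i` down-steps all of whose points
have height at most `h`. The bound `h` is an integer: for `h = -1` there is no such path, as
the starting point has height `0`. -/
def boundedCatalan (i : ℕ) (h : ℤ) : ℕ :=
  Set.ncard {w : DyckWord | w.semilength = i ∧ ∀ k, dyckHeight w k ≤ h}

end

/-! The lift of `f_r` to `ℝ` is monotone and has a lower adjoint, sending `t` to the first lifted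
point strictly after `t - r`. Hence a point `s` lies in the `n`-th range iff `n` steps of the
adjoint do not merge `s` with its successor (`mem_range_iterate_fwd_iff`). In a frame moving by `r`
per step this concerns two searchers starting at `s` and moving right: `u` looks in turn for a point
of `X + r`, `X + 2r`, ..., and `v` for a point of `X`, `X + r`, .... The point is at level `i` iff
`u i ≠ v (i + 1)` and `u (i + 1) = v (i + 2)`.

Let `r = p / q`. Then `X + e r` depends only on `e` mod `q`, and a sweep of the window `(s, s +
1/q)` meets each other sample point once, labelled by a residue. Given the positions mod `1/q`,
these labels are independent and uniform (`exists_word`). If the searchers have made `a` and `b`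
finds, each letter that matters changes `a - b` by `1` or `-1` with equal probability. Level `i`
means that `a - b` reaches `-1` at the state `(i, i + 1)` before reaching `q - 1`: a Dyck path of
height at most `q - 2` followed by a down-step, which gives `C_{i,q-2} / 2^(2i+1)`. The window ends
too early with probability `O((1 - 1/q)^m)`, where `m = n - 1` (`le_sum_walkRun`).

For irrational `r`, replacing `r` by `r'` changes the map at no more than `n² |r - r'|` points on
average, and each of them affects the level count by at most `2i + 1`
(`abs_meanLev_sub_meanLev_le_abs`). A Dirichlet approximation `p / q` with `q ≤ n / K` makes `n |r -
p/q|` of order `K / q`, while the error of the rational case is of order `exp (-K / 2)`. As `q` is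
large, the height bound `q - 2` plays no role. -/

/-! ### Clockwise distance and the cyclic map. -/

theorem coe_cwDist (x y : UnitAddCircle) : ((cwDist x y : ℝ) : UnitAddCircle) = y - x :=
  AddCircle.coe_equivIco

theorem cwDist_nonneg (x y : UnitAddCircle) : 0 ≤ cwDist x y :=
  (AddCircle.equivIco 1 0 (y - x)).2.1

theorem cwDist_lt_one (x y : UnitAddCircle) : cwDist x y < 1 := by
  exact (AddCircle.equivIco 1 0 (y - x)).2.2.trans_eq (zero_add 1)

theorem cwDist_eq_of_coe {x y : UnitAddCircle} {d : ℝ} (h0 : 0 ≤ d) (h1 : d < 1)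
    (h : (d : UnitAddCircle) = y - x) : cwDist x y = d := by
  unfold cwDist
  rw [← h]
  exact AddCircle.equivIco_coe_of_mem ⟨h0, by simpa using h1⟩

theorem cwDist_right_injective (x : UnitAddCircle) : Function.Injective (cwDist x) := by
  intro y z h
  have h' := congrArg (fun t : ℝ => (t : UnitAddCircle)) h
  simp only [coe_cwDist] at h'
  exact sub_left_injective h'

theorem cyclicMap_eq_iff {X : Finset UnitAddCircle} {r : ℝ} {hr : 0 < r} {x y : X} :
    cyclicMap X r hr x = y ↔
      cwDist x y < r ∧ ∀ z : X, cwDist x z < r → cwDist x z ≤ cwDist x y := by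
  constructor
  · rintro rfl
    exact cyclicMap_spec X r hr x
  · rintro ⟨h1, h2⟩
    obtain ⟨h3, h4⟩ := cyclicMap_spec X r hr x
    exact Subtype.ext (cwDist_right_injective x (le_antisymm (h2 _ h3) (h4 _ h1)))

/-! ### The lift to the real line and its Galois connection. -/

theorem UnitAddCircle.coe_eq_coe_iff {s t : ℝ} :
    (s : UnitAddCircle) = t ↔ ∃ m : ℤ, s = t + m := by
  rw [← sub_eq_zero, ← AddCircle.coe_sub, AddCircle.coe_eq_zero_iff]
  constructor
  · rintro ⟨m, hm⟩
    exact ⟨m, by simp at hm; linarith⟩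
  · rintro ⟨m, hm⟩
    exact ⟨m, by simp; linarith⟩

theorem UnitAddCircle.coe_add_int (t : ℝ) (m : ℤ) : ((t + m : ℝ) : UnitAddCircle) = t :=
  UnitAddCircle.coe_eq_coe_iff.2 ⟨m, rfl⟩

/-- The preimage in `ℝ` of a set of points of the circle. -/
abbrev RealLift (X : Finset UnitAddCircle) : Type := {t : ℝ // (t : UnitAddCircle) ∈ X}

namespace RealLift

variable {X : Finset UnitAddCircle}

/-- The covering projection. -/
def proj (t : RealLift X) : X := ⟨(t.1 : UnitAddCircle), t.2⟩

/-- Translation by an integer. -/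
def shift (m : ℤ) (t : RealLift X) : RealLift X :=
  ⟨t.1 + m, by rw [UnitAddCircle.coe_add_int]; exact t.2⟩

theorem proj_shift (m : ℤ) (t : RealLift X) : proj (shift m t) = proj t :=
  Subtype.ext (UnitAddCircle.coe_add_int _ _)

theorem proj_surjective : Function.Surjective (proj (X := X)) := by
  rintro ⟨x, hx⟩
  obtain ⟨t, rfl⟩ := QuotientAddGroup.mk_surjective x
  exact ⟨⟨t, hx⟩, rfl⟩

theorem exists_shift_of_proj_eq {s t : RealLift X} (h : proj s = proj t) :
    ∃ m : ℤ, s = shift m t := by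
  obtain ⟨m, hm⟩ := UnitAddCircle.coe_eq_coe_iff.1 (congrArg Subtype.val h)
  exact ⟨m, Subtype.ext hm⟩

theorem exists_isLeast (hX : X.Nonempty) (t : ℝ) :
    ∃ y : RealLift X, ∀ z : RealLift X, y ≤ z ↔ t < z.1 := by
  -- The next point after `t` is the one with the largest clockwise distance to `t`. A point at `t`
  -- itself has distance `0` and is sent to `t + 1`, which gives the strict inequality.
  obtain ⟨x, hx, hmax⟩ := X.exists_max_image (fun z => cwDist z (t : UnitAddCircle)) hX
  have key : ∀ z : UnitAddCircle, (((t - cwDist z t + 1 : ℝ)) : UnitAddCircle) = z := by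
    intro z
    have := UnitAddCircle.coe_add_int (t - cwDist z t) 1
    push_cast at this
    rw [this, AddCircle.coe_sub, coe_cwDist]
    simp
  refine ⟨⟨t - cwDist x t + 1, by rw [key]; exact hx⟩, fun z => ⟨fun h => ?_, fun h => ?_⟩⟩
  · have h' : t - cwDist x t + 1 ≤ z.1 := h
    have := cwDist_lt_one x t
    linarith
  · change t - cwDist x t + 1 ≤ z.1
    have h1 := hmax _ z.2
    obtain ⟨m, hm⟩ := UnitAddCircle.coe_eq_coe_iff.1 (key z.1)
    have h2 := cwDist_nonneg (z.1 : UnitAddCircle) t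
    have h3 : (m : ℝ) < 1 := by linarith
    have h4 : m ≤ 0 := by
      have : m < 1 := by exact_mod_cast h3
      omega
    have h5 : (m : ℝ) ≤ 0 := by exact_mod_cast h4
    linarith

/-- The first lifted point strictly after `t`. -/
noncomputable def next (hX : X.Nonempty) (t : ℝ) : RealLift X := (exists_isLeast hX t).choose

theorem next_le_iff (hX : X.Nonempty) {t : ℝ} {z : RealLift X} : next hX t ≤ z ↔ t < z.1 :=
  (exists_isLeast hX t).choose_spec z

theorem lt_next (hX : X.Nonempty) (t : ℝ) : t < (next hX t).1 :=
  (next_le_iff hX).1 le_rfl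

variable (X) in
/-- The lift of the map `cyclicMap` to the real line. -/
noncomputable def fwd (r : ℝ) (hr : 0 < r) (t : RealLift X) : RealLift X :=
  ⟨t.1 + cwDist (t.1 : UnitAddCircle) (cyclicMap X r hr (proj t)), by
    rw [AddCircle.coe_add, coe_cwDist]
    simp⟩

theorem proj_fwd {r : ℝ} (hr : 0 < r) (t : RealLift X) :
    proj (fwd X r hr t) = cyclicMap X r hr (proj t) := by
  refine Subtype.ext ?_
  change ((t.1 + cwDist (t.1 : UnitAddCircle) (cyclicMap X r hr (proj t)) : ℝ) : UnitAddCircle) = _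
  rw [AddCircle.coe_add, coe_cwDist]
  simp

theorem fwd_shift {r : ℝ} (hr : 0 < r) (m : ℤ) (t : RealLift X) :
    fwd X r hr (shift m t) = shift m (fwd X r hr t) := by
  refine Subtype.ext ?_
  change t.1 + m + cwDist ((t.1 + m : ℝ) : UnitAddCircle) (cyclicMap X r hr (proj (shift m t))) =
    t.1 + cwDist (t.1 : UnitAddCircle) (cyclicMap X r hr (proj t)) + m
  rw [UnitAddCircle.coe_add_int, proj_shift]
  ring

theorem le_fwd_iff {r : ℝ} (hr : 0 < r) (hr1 : r ≤ 1) {y t : RealLift X} :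
    y ≤ fwd X r hr t ↔ y.1 < t.1 + r := by
  obtain ⟨h1, h2⟩ := cyclicMap_spec X r hr (proj t)
  constructor
  · intro h
    exact lt_of_le_of_lt h (add_lt_add_right h1 t.1)
  · intro h
    change y.1 ≤ t.1 + cwDist (t.1 : UnitAddCircle) (cyclicMap X r hr (proj t))
    by_cases hy : y.1 < t.1
    · have := cwDist_nonneg (t.1 : UnitAddCircle) (cyclicMap X r hr (proj t))
      linarith
    · have h3 : cwDist (proj t) (proj y) = y.1 - t.1 :=
        cwDist_eq_of_coe (by linarith) (by linarith) (AddCircle.coe_sub _ _ _)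
      have h4 := h2 (proj y) (by rw [h3]; linarith)
      rw [h3] at h4
      change y.1 - t.1 ≤ cwDist (t.1 : UnitAddCircle) (cyclicMap X r hr (proj t)) at h4
      linarith

/-- The lower adjoint of `fwd`: the first lifted point strictly after `t - r`. -/
noncomputable def back (hX : X.Nonempty) (r : ℝ) (t : RealLift X) : RealLift X :=
  next hX (t.1 - r)

theorem gc_back_fwd (hX : X.Nonempty) {r : ℝ} (hr : 0 < r) (hr1 : r ≤ 1) :
    GaloisConnection (back hX r) (fwd X r hr) := by
  intro s t
  rw [back, next_le_iff, le_fwd_iff hr hr1]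
  exact sub_lt_iff_lt_add

theorem gc_iterate {α : Type*} [Preorder α] {l u : α → α} (h : GaloisConnection l u) (n : ℕ) :
    GaloisConnection l^[n] u^[n] := by
  induction n with
  | zero => exact GaloisConnection.id
  | succ n ih =>
    rw [Function.iterate_succ, Function.iterate_succ']
    exact h.compose ih

theorem iterate_fwd_shift {r : ℝ} (hr : 0 < r) (m : ℤ) (n : ℕ) (t : RealLift X) :
    (fwd X r hr)^[n] (shift m t) = shift m ((fwd X r hr)^[n] t) :=
  ((Function.Commute.iterate_left (f := fwd X r hr) (g := shift m) (fun t => fwd_shift hr m t) n) t)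

theorem proj_mem_range_iterate_iff {r : ℝ} (hr : 0 < r) (n : ℕ) (s : RealLift X) :
    proj s ∈ Set.range (cyclicMap X r hr)^[n] ↔ s ∈ Set.range (fwd X r hr)^[n] := by
  have hsc : Function.Semiconj (proj (X := X)) (fwd X r hr)^[n] (cyclicMap X r hr)^[n] :=
    Function.Semiconj.iterate_right (fun t => proj_fwd hr t) n
  constructor
  · rintro ⟨x, hx⟩
    obtain ⟨y, rfl⟩ := proj_surjective x
    rw [← hsc.eq] at hx
    obtain ⟨m, hm⟩ := exists_shift_of_proj_eq hx.symm
    exact ⟨shift m y, by rw [iterate_fwd_shift, hm]⟩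
  · rintro ⟨y, rfl⟩
    exact ⟨proj y, (hsc.eq y).symm⟩

/-- For a Galois connection `(l, u)`, `s` is in the range of `u` iff `u (l s) = s`. As `s ≤ u (l s)`
always, failure means `next s ≤ u (l s)`, that is, `l (next s) ≤ l s`. -/
theorem mem_range_iterate_fwd_iff (hX : X.Nonempty) {r : ℝ} (hr : 0 < r) (hr1 : r ≤ 1) (n : ℕ)
    (s : RealLift X) :
    s ∈ Set.range (fwd X r hr)^[n] ↔ (back hX r)^[n] s ≠ (back hX r)^[n] (next hX s.1) := by
  have gc := gc_iterate (gc_back_fwd hX hr hr1) n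
  have hlt : s < next hX s.1 := lt_next hX s.1
  have hle : (back hX r)^[n] s ≤ (back hX r)^[n] (next hX s.1) := gc.monotone_l hlt.le
  constructor
  · rintro ⟨y, rfl⟩ h
    have h1 := gc.l_u_le y
    rw [h, gc.le_iff_le] at h1
    exact absurd hlt (not_lt.2 h1)
  · intro h
    refine ⟨(back hX r)^[n] s, le_antisymm ?_ (gc.le_u_l s)⟩
    by_contra hcon
    have h1 : next hX s.1 ≤ (fwd X r hr)^[n] ((back hX r)^[n] s) :=
      (next_le_iff hX).2 (not_le.1 hcon)
    rw [← gc.le_iff_le] at h1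
    exact h (le_antisymm hle h1)

/-- Membership in the ranges of the iterates of `cyclicMap` in terms of two chains of points, in a
frame that moves with speed `r`. -/
theorem exists_chains {r : ℝ} (hr : 0 < r) (hr1 : r ≤ 1) (s : RealLift X) :
    ∃ u v : ℕ → ℝ, u 0 = s.1 ∧ v 0 = s.1 ∧
      (∀ j : ℕ, IsLeast ({t | ((t - (j + 1 : ℕ) * r : ℝ) : UnitAddCircle) ∈ X} ∩ Set.Ioi (u j))
        (u (j + 1))) ∧
      (∀ j : ℕ, IsLeast ({t | ((t - j * r : ℝ) : UnitAddCircle) ∈ X} ∩ Set.Ioi (v j))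
        (v (j + 1))) ∧
      ∀ i, proj s ∈ Set.range (cyclicMap X r hr)^[i] ↔ u i ≠ v (i + 1) := by
  have hX : X.Nonempty := ⟨_, s.2⟩
  have least : ∀ (w : ℝ) (j : ℕ) (t : ℝ), t = w + j * r →
      IsLeast ({t | ((t - j * r : ℝ) : UnitAddCircle) ∈ X} ∩ Set.Ioi t)
        ((next hX w).1 + j * r) := by
    rintro w j t rfl
    refine ⟨⟨?_, ?_⟩, ?_⟩
    · simpa using (next hX w).2
    · simpa using lt_next hX w
    · rintro z ⟨hz, hz'⟩
      have h1 : w < z - j * r := by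
        have : w + j * r < z := hz'
        linarith
      have h2 : (next hX w).1 ≤ z - j * r :=
        (next_le_iff hX (z := (⟨z - j * r, hz⟩ : RealLift X))).2 h1
      linarith
  -- The first move of `v` goes from `s` to its successor without a rotation. This delays `v` by one
  -- index and lets both chains start at `s`.
  refine ⟨fun j => ((back hX r)^[j] s).1 + j * r,
    fun j => match j with
      | 0 => s.1
      | j + 1 => ((back hX r)^[j] (next hX s.1)).1 + j * r, by simp, rfl, ?_, ?_, ?_⟩
  · intro j
    simp only [Function.iterate_succ_apply']
    exact least _ (j + 1) _ (by push_cast; ring)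
  · rintro (_ | j)
    · exact least _ 0 _ (by simp)
    · simp only [Function.iterate_succ_apply']
      exact least _ (j + 1) _ (by push_cast; ring)
  · intro i
    rw [proj_mem_range_iterate_iff, mem_range_iterate_fwd_iff hX hr hr1, not_iff_not]
    simp [Subtype.ext_iff]

end RealLift

/-! A walk driven by a word in `ZMod q`. In the state `(a, b)` the first searcher looks for the
letter `a + 1` and the second one for the letter `b`. -/

/-- The states in which the walk stops: the searchers have met, or they look for the same letter
forever, or the first searcher has passed the level `i`. -/
def Absorbed (q i : ℕ) (s : ℕ × ℕ) : Prop := s.2 = s.1 + 1 ∨ s.2 + q ≤ s.1 + 1 ∨ i + 1 ≤ s.1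

instance (q i : ℕ) (s : ℕ × ℕ) : Decidable (Absorbed q i s) := by
  unfold Absorbed
  infer_instance

/-- One step of the walk. -/
def walkStep (q i : ℕ) (s : ℕ × ℕ) (e : ZMod q) : ℕ × ℕ :=
  if Absorbed q i s then s
  else if e = ((s.1 + 1 : ℕ) : ZMod q) then (s.1 + 1, s.2)
  else if e = (s.2 : ZMod q) then (s.1, s.2 + 1)
  else s

/-- The state of the walk after reading a word. -/
def walkRun (q i : ℕ) : (m : ℕ) → (Fin m → ZMod q) → ℕ × ℕ → ℕ × ℕ
  | 0, _, s => s
  | m + 1, w, s => walkRun q i m (Fin.tail w) (walkStep q i s (w 0))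

theorem walkRun_of_absorbed {q i m : ℕ} (w : Fin m → ZMod q) {s : ℕ × ℕ} (hs : Absorbed q i s) :
    walkRun q i m w s = s := by
  induction m with
  | zero => rfl
  | succ m ih =>
    rw [walkRun, walkStep, if_pos hs]
    exact ih _

/-! ### The chains of finds and their reading by the walk. -/

/-- The two chains associated with a family of sets, starting from a common point. -/
structure Chains (S : ℕ → Set ℝ) (u v : ℕ → ℝ) : Prop where
  zero_eq : u 0 = v 0
  fst_isLeast : ∀ j, IsLeast (S (j + 1) ∩ Set.Ioi (u j)) (u (j + 1))
  snd_isLeast : ∀ j, IsLeast (S j ∩ Set.Ioi (v j)) (v (j + 1))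

/-- The position `t` lies between the last finds and the next finds of both searchers. -/
structure WalkInv (q : ℕ) (u v : ℕ → ℝ) (t : ℝ) (s : ℕ × ℕ) : Prop where
  le_succ : s.2 ≤ s.1 + 1
  succ_le : s.1 + 1 ≤ s.2 + q
  fst_le : u s.1 ≤ t
  lt_fst : t < u (s.1 + 1)
  snd_le : v s.2 ≤ t
  lt_snd : t < v (s.2 + 1)
  met : s.2 = s.1 + 1 → u s.1 < v s.2

theorem isLeast_inter_Ioi_congr {A : Set ℝ} {a b t y z : ℝ} (hy : IsLeast (A ∩ Set.Ioi a) y)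
    (hz : IsLeast (A ∩ Set.Ioi b) z) (hat : a ≤ t) (hbt : b ≤ t) (hty : t < y) (htz : t < z) :
    y = z :=
  le_antisymm (hy.2 ⟨hz.1.1, lt_of_le_of_lt hat htz⟩) (hz.2 ⟨hy.1.1, lt_of_le_of_lt hbt hty⟩)

namespace Chains

variable {S : ℕ → Set ℝ} {u v : ℕ → ℝ}

theorem fst_strictMono (h : Chains S u v) : StrictMono u :=
  strictMono_nat_of_lt_succ fun j => (h.fst_isLeast j).1.2

theorem snd_strictMono (h : Chains S u v) : StrictMono v :=
  strictMono_nat_of_lt_succ fun j => (h.snd_isLeast j).1.2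

theorem eq_succ (h : Chains S u v) {j : ℕ} (hj : u j = v (j + 1)) : u (j + 1) = v (j + 2) :=
  (h.fst_isLeast j).unique (hj ▸ h.snd_isLeast (j + 1))

theorem eq_of_le (h : Chains S u v) {j k : ℕ} (hjk : j ≤ k) (hj : u j = v (j + 1)) :
    u k = v (k + 1) := by
  induction k, hjk using Nat.le_induction with
  | base => exact hj
  | succ k _ ih => exact h.eq_succ ih

theorem walkInv_zero (h : Chains S u v) {q : ℕ} (hq : 0 < q) : WalkInv q u v (v 0) (0, 0) where
  le_succ := by simp
  succ_le := by simpa using Nat.succ_le_of_lt hq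
  fst_le := h.zero_eq.le
  lt_fst := h.zero_eq ▸ (h.fst_isLeast 0).1.2
  snd_le := le_rfl
  lt_snd := (h.snd_isLeast 0).1.2
  met := by simp

/-- At `(i, i + 1)` both searchers look for the same set `S (i + 1)` beyond the same position `t`,
so their next finds agree. The field `met` says that their last finds differ. -/
theorem level_of_walkInv (h : Chains S u v) {q i : ℕ} {t : ℝ} (hw : WalkInv q u v t (i, i + 1)) :
    u i ≠ v (i + 1) ∧ u (i + 1) = v (i + 2) :=
  ⟨(hw.met rfl).ne, isLeast_inter_Ioi_congr (h.fst_isLeast i) (h.snd_isLeast (i + 1))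
    hw.fst_le hw.snd_le hw.lt_fst hw.lt_snd⟩

/-- Once the chains agree they agree forever, so the level is determined by the first agreement.
Meeting at another state, or `a > i` without a meeting, puts this agreement at the wrong index. -/
theorem not_level_of_walkInv (h : Chains S u v) {q i : ℕ} (hq : 0 < q)
    (hS : ∀ e, S (e + q) = S e) {t : ℝ} {s : ℕ × ℕ} (hw : WalkInv q u v t s)
    (hs : Absorbed q i s) (hne : s ≠ (i, i + 1)) :
    ¬ (u i ≠ v (i + 1) ∧ u (i + 1) = v (i + 2)) := by
  obtain ⟨a, b⟩ := s
  have hle := hw.le_succ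
  have hle' := hw.succ_le
  have h1 := hw.fst_le
  have h2 := hw.lt_fst
  have h3 := hw.snd_le
  have h4 := hw.lt_snd
  dsimp only at hle hle' h1 h2 h3 h4
  rintro ⟨hi, hi'⟩
  by_cases hba : b = a + 1
  · subst hba
    have h5 : u (a + 1) = v (a + 2) :=
      isLeast_inter_Ioi_congr (h.fst_isLeast a) (h.snd_isLeast (a + 1)) h1 h3 h2 h4
    rcases lt_trichotomy a i with hai | rfl | hai
    · exact hi (h.eq_of_le hai h5)
    · exact hne rfl
    · exact (hw.met rfl).ne (h.eq_of_le (j := i + 1) hai hi')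
  · rcases hs with hs | hs | hs
    · exact hba hs
    · dsimp only at hs
      -- From here on the searchers look for the same residues, so `u (b + q + j) = v (b + 1 + j)`
      -- for all `j`. An agreement `u k = v (k + 1)` from `k = i + 1` on would then make `u` repeat
      -- a value.
      have hab : a + 1 = b + q := by omega
      rw [hab] at h2
      have h5 : ∀ j, u (b + q + j) = v (b + 1 + j) := by
        intro j
        induction j with
        | zero =>
          have h6 := h.fst_isLeast a
          rw [hab, hS] at h6
          exact isLeast_inter_Ioi_congr h6 (h.snd_isLeast b) h1 h3 h2 h4
        | succ j ih =>
          have h6 := h.fst_isLeast (b + q + j)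
          have h7 := h.snd_isLeast (b + 1 + j)
          rw [show b + q + j + 1 = b + 1 + j + q by ring, hS, ih] at h6
          rw [show b + q + (j + 1) = b + 1 + j + q by ring]
          exact h6.unique h7
      have h6 := h.eq_of_le (j := i + 1) (k := i + 1 + b) (by omega) hi'
      have h7 := h5 (i + 1)
      rw [show b + 1 + (i + 1) = i + 1 + b + 1 by ring, ← h6] at h7
      have := h.fst_strictMono.injective h7
      omega
    · dsimp only at hs
      have h5 := h.eq_of_le (j := i + 1) hs hi'
      have h6 : v (b + 1) ≤ v (a + 1) := h.snd_strictMono.monotone (by omega)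
      linarith

/-- The sets have no point strictly between `t₀` and the first window point `τ 0`. So a searcher
looking for the letter of `τ 0` finds it there, and the target of any other searcher lies further
on. -/
theorem exists_walkInv_run (h : Chains S u v) {q i : ℕ} {x₁ : ℝ} {m : ℕ} (τ : Fin m → ℝ)
    (w : Fin m → ZMod q) (t₀ : ℝ) (s : ℕ × ℕ) (hτ : StrictMono τ) (h₀ : ∀ l, t₀ < τ l)
    (h₁ : ∀ l, τ l < x₁)
    (hwin : ∀ (e : ℕ) (t : ℝ), t₀ < t → t < x₁ → (t ∈ S e ↔ ∃ l, t = τ l ∧ w l = e))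
    (hw : WalkInv q u v t₀ s) : ∃ t, WalkInv q u v t (walkRun q i m w s) := by
  induction m generalizing t₀ s with
  | zero => exact ⟨t₀, hw⟩
  | succ m ih =>
    by_cases hs : Absorbed q i s
    · rw [walkRun_of_absorbed w hs]
      exact ⟨t₀, hw⟩
    obtain ⟨a, b⟩ := s
    have hle := hw.le_succ
    have hle' := hw.succ_le
    have g1 := hw.fst_le
    have g2 := hw.lt_fst
    have g3 := hw.snd_le
    have g4 := hw.lt_snd
    dsimp only at hle hle' g1 g2 g3 g4
    have hs' : b ≤ a ∧ a + 1 < b + q := by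
      simp only [Absorbed, not_or] at hs
      omega
    -- Before absorption `0 < a + 1 - b < q`, so a letter serves at most one searcher.
    have hne : ((a + 1 : ℕ) : ZMod q) ≠ (b : ZMod q) := by
      intro hab
      rw [ZMod.natCast_eq_natCast_iff] at hab
      have hd := (Nat.modEq_iff_dvd' (show b ≤ a + 1 by omega)).1 hab.symm
      have := Nat.le_of_dvd (by omega) hd
      omega
    have hmin : ∀ l, τ 0 ≤ τ l := fun l => hτ.monotone (Fin.zero_le l)
    have later : ∀ (c : ℕ) (z : ℝ), z ∈ S c → t₀ < z → w 0 ≠ c → τ 0 < z := by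
      intro c z hz hz0 hwc
      by_contra hcon
      have hz1 : z < x₁ := lt_of_le_of_lt (not_lt.1 hcon) (h₁ 0)
      obtain ⟨l, rfl, hl⟩ := (hwin c z hz0 hz1).1 hz
      have : l = 0 := hτ.injective (le_antisymm (not_lt.1 hcon) (hmin l))
      exact hwc (this ▸ hl)
    have found : ∀ (c : ℕ) (y z : ℝ), IsLeast (S c ∩ Set.Ioi y) z → y ≤ t₀ → t₀ < z → w 0 = c →
        z = τ 0 := by
      intro c y z hz hy hz0 hwc
      have hmem : τ 0 ∈ S c := (hwin c _ (h₀ 0) (h₁ 0)).2 ⟨0, rfl, hwc⟩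
      have hzle : z ≤ τ 0 := hz.2 ⟨hmem, lt_of_le_of_lt hy (h₀ 0)⟩
      obtain ⟨l, rfl, -⟩ := (hwin c z hz0 (lt_of_le_of_lt hzle (h₁ 0))).1 hz.1.1
      exact le_antisymm hzle (hmin l)
    refine ih (Fin.tail τ) (Fin.tail w) (τ 0) _ (fun k l hkl => hτ (Fin.succ_lt_succ_iff.2 hkl))
      (fun l => hτ (Fin.succ_pos l)) (fun l => h₁ _) ?_ ?_
    · intro e t ht ht'
      rw [hwin e t ((h₀ 0).trans ht) ht', Fin.exists_fin_succ]
      exact or_iff_right fun h' => ht.ne' h'.1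
    · rw [walkStep, if_neg hs]
      dsimp only
      split_ifs with e1 e2
      · have hu := found _ _ _ (h.fst_isLeast a) g1 g2 e1
        refine ⟨by dsimp only; omega, by dsimp only; omega, hu.le, ?_, g3.trans (h₀ 0).le, ?_,
          fun h' => ?_⟩
        · rw [← hu]
          exact h.fst_strictMono (Nat.lt_succ_self _)
        · exact later b _ (h.snd_isLeast b).1.1 g4 (e1 ▸ hne)
        · dsimp only at h'
          omega
      · have hv := found _ _ _ (h.snd_isLeast b) g3 g4 e2
        refine ⟨by dsimp only; omega, by dsimp only; omega, g1.trans (h₀ 0).le, ?_, hv.le, ?_,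
          fun _ => lt_of_le_of_lt g1 g4⟩
        · exact later _ _ (h.fst_isLeast a).1.1 g2 e1
        · rw [← hv]
          exact h.snd_strictMono (Nat.lt_succ_self _)
      · exact ⟨hle, hle', g1.trans (h₀ 0).le, later _ _ (h.fst_isLeast a).1.1 g2 e1,
          g3.trans (h₀ 0).le, later _ _ (h.snd_isLeast b).1.1 g4 e2, hw.met⟩

end Chains

/-! ### Counting lattice paths of bounded height. -/

/-- The number of lattice paths with `l` steps `±1` from the height `y` to the height `0` that stay
nonnegative, and below `h` after each up-step. -/
def pathCount (h : ℤ) : ℕ → ℕ → ℕ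
  | 0, y => if y = 0 then 1 else 0
  | l + 1, y => (if (y : ℤ) + 1 ≤ h then pathCount h l (y + 1) else 0) +
      if y = 0 then 0 else pathCount h l (y - 1)

theorem pathCount_of_lt {h : ℤ} {l y : ℕ} (hly : l < y) : pathCount h l y = 0 := by
  induction l generalizing y with
  | zero => simp [pathCount, hly.ne']
  | succ l ih =>
    obtain ⟨y, rfl⟩ : ∃ z, y = z + 1 := ⟨y - 1, by omega⟩
    simp [pathCount, ih (show l < y + 1 + 1 by omega), ih (show l < y by omega)]

theorem pathCount_le (h : ℤ) (l y : ℕ) : pathCount h l y ≤ 2 ^ l := by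
  induction l generalizing y with
  | zero =>
    rw [pathCount]
    split_ifs <;> simp
  | succ l ih =>
    rw [pathCount, pow_succ, mul_two]
    refine Nat.add_le_add ?_ ?_
    · split_ifs
      · exact ih _
      · exact Nat.zero_le _
    · split_ifs
      · exact Nat.zero_le _
      · exact ih _

/-- The lists of steps counted by `pathCount`. -/
def pathSet (h : ℤ) (l y : ℕ) : Set (List DyckStep) :=
  {w | w.length = l ∧ (y : ℤ) + w.count DyckStep.U - w.count DyckStep.D = 0 ∧
    ∀ k, 0 ≤ (y : ℤ) + (w.take k).count DyckStep.U - (w.take k).count DyckStep.D ∧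
      (y : ℤ) + (w.take k).count DyckStep.U - (w.take k).count DyckStep.D ≤ h}

instance : Fintype DyckStep where
  elems := {DyckStep.U, DyckStep.D}
  complete s := by cases s <;> simp

theorem pathSet_finite (h : ℤ) (l y : ℕ) : (pathSet h l y).Finite :=
  (List.finite_length_eq DyckStep l).subset fun _ hw => hw.1

theorem cons_U_mem_pathSet {h : ℤ} {l y : ℕ} (hy : (y : ℤ) ≤ h) {w : List DyckStep} :
    DyckStep.U :: w ∈ pathSet h (l + 1) y ↔ (y : ℤ) + 1 ≤ h ∧ w ∈ pathSet h l (y + 1) := by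
  simp only [pathSet, Set.mem_ofPred_eq, List.length_cons, add_left_inj, List.count_cons_self]
  constructor
  · rintro ⟨h1, h2, h3⟩
    have h4 := fun k => h3 (k + 1)
    simp only [List.take_succ_cons, List.count_cons_self] at h4
    have h5 := h4 0
    simp at h5 h2
    refine ⟨h5.2, h1, by push_cast; linarith, fun k => ?_⟩
    have h6 := h4 k
    simp at h6
    push_cast
    constructor <;> linarith
  · rintro ⟨h0, h1, h2, h3⟩
    refine ⟨h1, by simp; push_cast at h2; linarith, fun k => ?_⟩
    cases k with
    | zero => simpa using hy
    | succ k =>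
      have h6 := h3 k
      simp
      push_cast at h6
      constructor <;> linarith

theorem cons_D_mem_pathSet {h : ℤ} {l y : ℕ} (hy : (y : ℤ) ≤ h) {w : List DyckStep} :
    DyckStep.D :: w ∈ pathSet h (l + 1) y ↔ ∃ z, y = z + 1 ∧ w ∈ pathSet h l z := by
  simp only [pathSet, Set.mem_ofPred_eq, List.length_cons, add_left_inj, List.count_cons_self]
  constructor
  · rintro ⟨h1, h2, h3⟩
    have h4 := fun k => h3 (k + 1)
    simp only [List.take_succ_cons, List.count_cons_self] at h4
    have h5 := h4 0
    simp at h5 h2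
    obtain ⟨z, rfl⟩ : ∃ z, y = z + 1 := ⟨y - 1, by omega⟩
    refine ⟨z, rfl, h1, by push_cast at h2; linarith, fun k => ?_⟩
    have h6 := h4 k
    simp at h6
    constructor <;> linarith
  · rintro ⟨z, rfl, h1, h2, h3⟩
    refine ⟨h1, by simp; linarith, fun k => ?_⟩
    cases k with
    | zero => simp at hy ⊢; exact ⟨by positivity, hy⟩
    | succ k =>
      have h6 := h3 k
      simp
      constructor <;> linarith

/-- The recursion tests the ceiling only after up-steps, so the starting height must satisfy it
separately. -/
theorem ncard_pathSet {h : ℤ} (l : ℕ) {y : ℕ} (hy : (y : ℤ) ≤ h) :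
    (pathSet h l y).ncard = pathCount h l y := by
  induction l generalizing y with
  | zero =>
    rw [pathCount]
    split_ifs with h0
    · subst h0
      rw [Set.ncard_eq_one]
      refine ⟨[], Set.eq_singleton_iff_unique_mem.2 ⟨?_, fun w hw => List.length_eq_zero_iff.1 hw.1⟩⟩
      simpa [pathSet] using hy
    · rw [Set.ncard_eq_zero (pathSet_finite _ _ _), Set.eq_empty_iff_forall_notMem]
      rintro w ⟨h1, h2, -⟩
      rw [List.length_eq_zero_iff] at h1
      subst h1
      simp at h2
      exact h0 h2
  | succ l ih =>
    have hsplit : pathSet h (l + 1) y =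
        (List.cons DyckStep.U '' {w | (y : ℤ) + 1 ≤ h ∧ w ∈ pathSet h l (y + 1)}) ∪
        (List.cons DyckStep.D '' {w | ∃ z, y = z + 1 ∧ w ∈ pathSet h l z}) := by
      ext w
      constructor
      · intro hw
        rcases w with _ | ⟨s, w⟩
        · exact absurd hw.1 (by simp)
        · cases s
          · exact Or.inl ⟨w, (cons_U_mem_pathSet hy).1 hw, rfl⟩
          · exact Or.inr ⟨w, (cons_D_mem_pathSet hy).1 hw, rfl⟩
      · rintro (⟨w, hw, rfl⟩ | ⟨w, hw, rfl⟩)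
        · exact (cons_U_mem_pathSet hy).2 hw
        · exact (cons_D_mem_pathSet hy).2 hw
    have hfin := pathSet_finite h (l + 1) y
    rw [hsplit] at hfin ⊢
    rw [Set.ncard_union_eq ?_ (hfin.subset Set.subset_union_left)
      (hfin.subset Set.subset_union_right), Set.ncard_image_of_injective _ List.cons_injective,
      Set.ncard_image_of_injective _ List.cons_injective, pathCount]
    · congr 1
      · split_ifs with h1
        · simp only [h1, true_and, Set.ofPred_mem_eq]
          exact ih (by push_cast; exact h1)
        · simp [h1]
      · cases y with
        | zero => simp
        | succ y =>
          rw [if_neg (Nat.succ_ne_zero y), Nat.add_sub_cancel, ← ih (show (y : ℤ) ≤ h by push_cast at hy; linarith)]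
          congr 1
          ext w
          simp
    · rw [Set.disjoint_left]
      rintro _ ⟨w, -, rfl⟩ ⟨w', -, h'⟩
      simp at h'

theorem boundedCatalan_eq_pathCount (i : ℕ) {h : ℤ} (hh : 0 ≤ h) :
    boundedCatalan i h = pathCount h (2 * i) 0 := by
  rw [← ncard_pathSet _ (by simpa using hh), boundedCatalan,
    ← Set.ncard_image_of_injective _ (show Function.Injective DyckWord.toList from
      fun _ _ => DyckWord.ext)]
  congr 1
  ext l
  constructor
  · rintro ⟨w, ⟨h1, h2⟩, rfl⟩
    refine ⟨by rw [← w.two_mul_semilength_eq_length, h1], ?_, fun k => ⟨?_, ?_⟩⟩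
    · rw [w.count_U_eq_count_D]
      simp
    · have := w.count_D_le_count_U k
      push_cast
      omega
    · have := h2 k
      rw [dyckHeight] at this
      push_cast
      linarith
  · rintro ⟨h1, h2, h3⟩
    push_cast at h2 h3
    refine ⟨⟨l, by omega, fun k => by have := (h3 k).1; omega⟩, ⟨?_, fun k => ?_⟩, rfl⟩
    · have := DyckWord.two_mul_semilength_eq_length
        (p := ⟨l, by omega, fun k => by have := (h3 k).1; omega⟩)
      simp only [h1] at this
      omega
    · have := (h3 k).2
      rw [dyckHeight]
      dsimp only
      linarith

theorem boundedCatalan_of_neg (i : ℕ) {h : ℤ} (hh : h < 0) : boundedCatalan i h = 0 := by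
  rw [boundedCatalan]
  convert Set.ncard_empty DyckWord
  rw [Set.eq_empty_iff_forall_notMem]
  rintro w ⟨-, h2⟩
  have := h2 0
  simp [dyckHeight] at this
  omega

theorem boundedCatalan_of_le {i : ℕ} {h : ℤ} (hh : (i : ℤ) ≤ h) :
    boundedCatalan i h = catalan i := by
  rw [← DyckWord.card_dyckWord_semilength_eq_catalan, ← Nat.card_eq_fintype_card, boundedCatalan,
    ← Nat.card_coe_set_eq]
  congr 1
  congr 1
  ext w
  refine ⟨fun hw => hw.1, fun hw => ⟨hw, fun k => ?_⟩⟩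
  have h1 : (w.toList.take k).count DyckStep.U ≤ w.toList.count DyckStep.U :=
    (List.take_sublist k _).count_le _
  have hw' : w.toList.count DyckStep.U = i := hw
  rw [dyckHeight]
  omega

/-! ### Absorption probabilities of the walk. -/

/-- The probability that the walk started in the state `s` and driven by an infinite uniformly
random word is absorbed in the state `(i, i + 1)`. -/
noncomputable def walkProb (q i : ℕ) (s : ℕ × ℕ) : ℝ :=
  if Absorbed q i s then if s = (i, i + 1) then 1 else 0
  else pathCount ((q : ℤ) - 2) (2 * i - s.1 - s.2) (s.1 - s.2) / 2 ^ (2 * i + 1 - s.1 - s.2)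

theorem walkProb_nonneg (q i : ℕ) (s : ℕ × ℕ) : 0 ≤ walkProb q i s := by
  unfold walkProb
  split_ifs <;> positivity

theorem walkProb_le_one (q i : ℕ) (s : ℕ × ℕ) : walkProb q i s ≤ 1 := by
  unfold walkProb
  split_ifs
  · exact le_rfl
  · exact zero_le_one
  · rw [div_le_one (by positivity)]
    refine le_trans (b := (2 : ℝ) ^ (2 * i - s.1 - s.2)) ?_
      (pow_le_pow_right₀ one_le_two (by omega))
    exact_mod_cast pathCount_le _ _ _

theorem walkProb_of_absorbed {q i : ℕ} {s : ℕ × ℕ} (hs : Absorbed q i s) :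
    walkProb q i s = if s = (i, i + 1) then 1 else 0 := by
  rw [walkProb, if_pos hs]

/-- First-step analysis: letters that serve no searcher can be ignored, and the other two are
equally likely. This is the recursion of `pathCount` at height `a - b`, with one extra down-step at
the end. -/
theorem walkProb_of_not_absorbed {q i a b : ℕ} (hba : b ≤ a + 1) (hs : ¬ Absorbed q i (a, b)) :
    walkProb q i (a, b) = (walkProb q i (a + 1, b) + walkProb q i (a, b + 1)) / 2 := by
  have hs' : b ≤ a ∧ a + 1 < b + q ∧ a ≤ i := by
    simp only [Absorbed, not_or] at hs
    omega
  obtain ⟨h1, h2, h3⟩ := hs'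
  by_cases hi : a = i ∧ b = i
  · obtain ⟨rfl, rfl⟩ := hi
    rw [walkProb, if_neg hs, walkProb_of_absorbed (by simp [Absorbed]),
      walkProb_of_absorbed (by simp [Absorbed])]
    have e1 : 2 * b - b - b = 0 := by omega
    have e2 : 2 * b + 1 - b - b = 1 := by omega
    simp [e1, e2, pathCount]
  · obtain ⟨l, hl⟩ : ∃ l, 2 * i - a - b = l + 1 := ⟨2 * i - a - b - 1, by omega⟩
    have hl' : 2 * i + 1 - a - b = l + 1 + 1 := by omega
    have hup : walkProb q i (a + 1, b) =
        ((if ((a - b : ℕ) : ℤ) + 1 ≤ (q : ℤ) - 2 then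
          pathCount ((q : ℤ) - 2) l (a - b + 1) else 0 : ℕ) : ℝ) / 2 ^ (l + 1) := by
      by_cases hab : Absorbed q i (a + 1, b)
      · rw [walkProb_of_absorbed hab, if_neg (by simp; omega)]
        split_ifs with hc
        -- Here absorption comes from `a = i`, and too few steps remain to return to height `0`.
        · rw [pathCount_of_lt]
          · simp
          · simp only [Absorbed] at hab
            omega
        · simp
      · rw [walkProb, if_neg hab]
        simp only [Absorbed, not_or] at hab
        dsimp only
        rw [if_pos (by omega), show 2 * i - (a + 1) - b = l by omega,
          show a + 1 - b = a - b + 1 by omega, show 2 * i + 1 - (a + 1) - b = l + 1 by omega]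
    have hdown : walkProb q i (a, b + 1) =
        ((if a - b = 0 then 0 else pathCount ((q : ℤ) - 2) l (a - b - 1) : ℕ) : ℝ) /
          2 ^ (l + 1) := by
      by_cases hab : a = b
      · subst hab
        rw [walkProb_of_absorbed (by simp [Absorbed]), if_neg (by simp; omega)]
        simp
      · rw [walkProb, if_neg (by simp only [Absorbed, not_or]; omega)]
        dsimp only
        rw [if_neg (by omega), show 2 * i - a - (b + 1) = l by omega,
          show a - (b + 1) = a - b - 1 by omega, show 2 * i + 1 - a - (b + 1) = l + 1 by omega]
    rw [hup, hdown, walkProb, if_neg hs]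
    dsimp only
    rw [hl, hl', pathCount, Nat.cast_add, pow_succ 2 (l + 1)]
    field_simp

theorem walkProb_zero {q : ℕ} (hq : 0 < q) (i : ℕ) :
    walkProb q i (0, 0) = (boundedCatalan i ((q : ℤ) - 2) : ℝ) / 2 ^ (2 * i + 1) := by
  by_cases h1 : q = 1
  · rw [walkProb_of_absorbed (by simp [Absorbed, h1]), boundedCatalan_of_neg i (by omega)]
    simp
  · rw [walkProb, if_neg (by simp only [Absorbed, not_or]; omega),
      boundedCatalan_eq_pathCount i (by omega)]
    simp

theorem sum_two_exceptions {ι : Type*} [Fintype ι] [DecidableEq ι] {x y : ι} (hxy : x ≠ y)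
    (A B C : ℝ) :
    ∑ e : ι, (if e = x then A else if e = y then B else C) =
      A + B + ((Fintype.card ι : ℝ) - 2) * C := by
  have : ∀ e : ι, (if e = x then A else if e = y then B else C) =
      C + (if e = x then A - C else 0) + (if e = y then B - C else 0) := by
    intro e
    by_cases h1 : e = x
    · have h2 : e ≠ y := h1 ▸ hxy
      rw [if_pos h1, if_pos h1, if_neg h2]
      ring
    · by_cases h2 : e = y
      · rw [if_neg h1, if_pos h2, if_neg h1, if_pos h2]
        ring
      · rw [if_neg h1, if_neg h2, if_neg h1, if_neg h2]
        ring
  rw [Finset.sum_congr rfl fun e _ => this e]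
  simp only [Finset.sum_add_distrib, Finset.sum_const, Finset.card_univ, Finset.sum_ite_eq',
    Finset.mem_univ, if_true, nsmul_eq_mul]
  ring

theorem sum_walkRun_succ (q i m : ℕ) [NeZero q] (φ : ℕ × ℕ → ℝ) (s : ℕ × ℕ) :
    ∑ w : Fin (m + 1) → ZMod q, φ (walkRun q i (m + 1) w s) =
      ∑ e : ZMod q, ∑ w : Fin m → ZMod q, φ (walkRun q i m w (walkStep q i s e)) := by
  rw [← (Fin.consEquiv fun _ : Fin (m + 1) => ZMod q).sum_comp, Fintype.sum_prod_type]
  refine Finset.sum_congr rfl fun e _ => Finset.sum_congr rfl fun w _ => ?_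
  simp [walkRun, Fin.consEquiv]

/-- The distribution of the walk after reading a uniformly random word of length `m` is close to
its distribution after absorption. -/
theorem le_sum_walkRun (q i : ℕ) [NeZero q] (φ π : ℕ × ℕ → ℝ) (hφ : ∀ s, 0 ≤ φ s)
    (hπ : ∀ s, π s ≤ 1) (habs : ∀ s, Absorbed q i s → π s = φ s)
    (hmean : ∀ a b, b ≤ a + 1 → ¬ Absorbed q i (a, b) →
      π (a, b) = (π (a + 1, b) + π (a, b + 1)) / 2)
    (m : ℕ) (a b : ℕ) (hba : b ≤ a + 1) :
    (q : ℝ) ^ m * π (a, b) - 2 ^ (2 * i + 3 - a - b) * ((q : ℝ) - 1) ^ m ≤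
      ∑ w : Fin m → ZMod q, φ (walkRun q i m w (a, b)) := by
  have hq : (1 : ℝ) ≤ q := by exact_mod_cast NeZero.one_le
  have hcard : Fintype.card (ZMod q) = q := ZMod.card q
  induction m generalizing a b with
  | zero =>
    have h1 : (1 : ℝ) ≤ 2 ^ (2 * i + 3 - a - b) := one_le_pow₀ one_le_two
    have h2 := hφ (a, b)
    have h3 := hπ (a, b)
    simp [walkRun]
    linarith
  | succ m ih =>
    by_cases hs : Absorbed q i (a, b)
    · simp only [walkRun_of_absorbed _ hs]
      rw [habs _ hs]
      simp only [Finset.sum_const, Finset.card_univ, Fintype.card_fun, hcard, Fintype.card_fin,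
        nsmul_eq_mul, Nat.cast_pow]
      have : (0 : ℝ) ≤ 2 ^ (2 * i + 3 - a - b) * ((q : ℝ) - 1) ^ (m + 1) :=
        mul_nonneg (by positivity) (pow_nonneg (by linarith) _)
      linarith
    · have hs' : b ≤ a ∧ a + 1 < b + q ∧ a ≤ i := by
        simp only [Absorbed, not_or] at hs
        omega
      obtain ⟨h1, h2, h3⟩ := hs'
      have hne : ((a + 1 : ℕ) : ZMod q) ≠ (b : ZMod q) := by
        intro hab
        rw [ZMod.natCast_eq_natCast_iff] at hab
        have hd := (Nat.modEq_iff_dvd' (show b ≤ a + 1 by omega)).1 hab.symm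
        have := Nat.le_of_dvd (by omega) hd
        omega
      have hq2 : (2 : ℝ) ≤ q := by exact_mod_cast (by omega : 2 ≤ q)
      obtain ⟨l, hl⟩ : ∃ l, 2 * i + 3 - a - b = l + 1 := ⟨2 * i + 3 - a - b - 1, by omega⟩
      have e1 := ih (a + 1) b (by omega)
      have e2 := ih a (b + 1) (by omega)
      have e3 := ih a b hba
      rw [show 2 * i + 3 - (a + 1) - b = l by omega] at e1
      rw [show 2 * i + 3 - a - (b + 1) = l by omega] at e2
      rw [hl] at e3 ⊢
      have key : ∑ w : Fin (m + 1) → ZMod q, φ (walkRun q i (m + 1) w (a, b)) =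
          ∑ w : Fin m → ZMod q, φ (walkRun q i m w (a + 1, b)) +
          ∑ w : Fin m → ZMod q, φ (walkRun q i m w (a, b + 1)) +
          ((q : ℝ) - 2) * ∑ w : Fin m → ZMod q, φ (walkRun q i m w (a, b)) := by
        have h4 := sum_two_exceptions hne (∑ w : Fin m → ZMod q, φ (walkRun q i m w (a + 1, b)))
          (∑ w : Fin m → ZMod q, φ (walkRun q i m w (a, b + 1)))
          (∑ w : Fin m → ZMod q, φ (walkRun q i m w (a, b)))
        rw [hcard] at h4
        rw [sum_walkRun_succ, ← h4]
        refine Finset.sum_congr rfl fun e _ => ?_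
        rw [walkStep, if_neg hs]
        dsimp only
        split_ifs <;> rfl
      rw [key]
      have e4 := mul_le_mul_of_nonneg_left e3 (show (0 : ℝ) ≤ (q : ℝ) - 2 by linarith)
      have e5 := hmean a b hba hs
      -- The error terms add up exactly: the two moves halve the power of two and the other `q - 2`
      -- letters keep it, so the factor is `1 + (q - 2) = q - 1`.
      refine le_trans (le_of_eq ?_) (add_le_add (add_le_add e1 e2) e4)
      rw [e5]
      ring

theorem le_card_walkRun_eq (q i m : ℕ) [NeZero q] :
    (q : ℝ) ^ m * walkProb q i (0, 0) - 2 ^ (2 * i + 3) * ((q : ℝ) - 1) ^ m ≤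
      ∑ w : Fin m → ZMod q, if walkRun q i m w (0, 0) = (i, i + 1) then 1 else 0 :=
  le_sum_walkRun q i (fun s => if s = (i, i + 1) then 1 else 0) (walkProb q i)
    (fun s => by split_ifs <;> simp) (walkProb_le_one q i)
    (fun _ => walkProb_of_absorbed) (fun _ _ => walkProb_of_not_absorbed) m 0 0 (by simp)

/-- The same lower bound for absorption elsewhere. Together with `le_card_walkRun_eq` it yields a
two-sided estimate. -/
theorem le_card_walkRun_ne (q i m : ℕ) [NeZero q] :
    (q : ℝ) ^ m * (1 - walkProb q i (0, 0)) - 2 ^ (2 * i + 3) * ((q : ℝ) - 1) ^ m ≤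
      ∑ w : Fin m → ZMod q, if Absorbed q i (walkRun q i m w (0, 0)) ∧
        walkRun q i m w (0, 0) ≠ (i, i + 1) then 1 else 0 :=
  le_sum_walkRun q i (fun s => if Absorbed q i s ∧ s ≠ (i, i + 1) then 1 else 0)
    (fun s => 1 - walkProb q i s)
    (fun s => by split_ifs <;> simp)
    (fun s => by linarith [walkProb_nonneg q i s])
    (fun s hs => by
      rw [walkProb_of_absorbed hs]
      by_cases h : s = (i, i + 1) <;> simp [h, hs])
    (fun a b hba hs => by rw [walkProb_of_not_absorbed hba hs]; ring) m 0 0 (by simp)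

/-! ### Random rotations of the sample by multiples of `1 / q`. -/

theorem mem_sampleSet {n : ℕ} (x : Fin n → UnitAddCircle) (k : Fin n) : x k ∈ sampleSet x := by
  classical
  exact Finset.mem_image_of_mem x (Finset.mem_univ k)

theorem mem_sampleSet_iff {n : ℕ} {x : Fin n → UnitAddCircle} {y : UnitAddCircle} :
    y ∈ sampleSet x ↔ ∃ k, x k = y := by
  classical
  simp [sampleSet]

/-- The `k`-th point of the sample is at level `i`. -/
def LevelAt (i : ℕ) (r : ℝ) (hr : 0 < r) {n : ℕ} (x : Fin n → UnitAddCircle) (k : Fin n) : Prop :=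
  (⟨x k, mem_sampleSet x k⟩ : sampleSet x) ∈
    Set.range (cyclicMap (sampleSet x) r hr)^[i] \ Set.range (cyclicMap (sampleSet x) r hr)^[i + 1]

theorem exists_eq_coe_add_toAddCircle (q : ℕ) [NeZero q] (d : UnitAddCircle) :
    ∃ θ : ℝ, ∃ M : ZMod q, (0 ≤ θ ∧ θ < 1 / q) ∧ d = (θ : UnitAddCircle) + ZMod.toAddCircle M := by
  obtain ⟨t, rfl⟩ := QuotientAddGroup.mk_surjective d
  have hq : (0 : ℝ) < q := by exact_mod_cast NeZero.pos q
  refine ⟨Int.fract (q * t) / q, (⌊q * t⌋ : ℤ), ⟨by have := Int.fract_nonneg (q * t); positivity,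
    div_lt_div_of_pos_right (Int.fract_lt_one _) hq⟩, ?_⟩
  rw [ZMod.toAddCircle_intCast, ← AddCircle.coe_add, ← add_div, Int.fract_add_floor,
    mul_div_cancel_left₀ t hq.ne']

theorem coe_eq_toAddCircle_iff {q : ℕ} [NeZero q] {t : ℝ} (ht : |t| < 1 / q) {a : ZMod q} :
    (t : UnitAddCircle) = ZMod.toAddCircle a ↔ t = 0 ∧ a = 0 := by
  have hq : (0 : ℝ) < q := by exact_mod_cast NeZero.pos q
  constructor
  · intro h
    have h1 := h
    rw [ZMod.toAddCircle_apply, UnitAddCircle.coe_eq_coe_iff] at h1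
    obtain ⟨m, hm⟩ := h1
    have h2 : t * q = ((a.val + m * q : ℤ) : ℝ) := by
      rw [hm]
      push_cast
      field_simp
    have h3 : |t * q| < 1 := by
      rw [abs_mul, abs_of_pos hq]
      exact (lt_div_iff₀ hq).1 ht
    rw [h2, ← Int.cast_abs] at h3
    have h4 : ((a.val + m * q : ℤ) : ℤ) = 0 := by
      rw [← Int.abs_lt_one_iff]
      exact_mod_cast h3
    rw [h4] at h2
    have h5 : t = 0 := by
      rcases mul_eq_zero.1 (h2.trans Int.cast_zero) with h | h
      · exact h
      · exact absurd h hq.ne'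
    refine ⟨h5, ?_⟩
    rw [h5, AddCircle.coe_zero] at h
    exact ZMod.toAddCircle_eq_zero.1 h.symm
  · rintro ⟨rfl, rfl⟩
    simp

theorem nsmul_toAddCircle {q : ℕ} [NeZero q] (a : ZMod q) :
    q • (ZMod.toAddCircle a : UnitAddCircle) = 0 := by
  rw [← map_nsmul]
  simp

/-- Rotating the points of a sample by multiples of `1 / q` makes the word that is read after a
given point run through all words. -/
theorem exists_word {p q : ℕ} [NeZero q] (hpq : p.Coprime q) (i : ℕ) {r : ℝ} (hr : 0 < r)
    (hr1 : r ≤ 1) (hrpq : r = p / q) {m : ℕ} (x : Fin (m + 1) → UnitAddCircle)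
    (hx : Function.Injective fun j => q • x j) (k : Fin (m + 1)) :
    ∃ word : (Fin (m + 1) → ZMod q) → Fin m → ZMod q,
      Function.Bijective (fun c => (c k, word c)) ∧
      (∀ c, walkRun q i m (word c) (0, 0) = (i, i + 1) →
        LevelAt i r hr (fun j => x j + ZMod.toAddCircle (c j)) k) ∧
      ∀ c, Absorbed q i (walkRun q i m (word c) (0, 0)) →
        walkRun q i m (word c) (0, 0) ≠ (i, i + 1) →
        ¬ LevelAt i r hr (fun j => x j + ZMod.toAddCircle (c j)) k := by
  classical
  have hq0 : 0 < q := NeZero.pos q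
  have hq : (0 : ℝ) < q := by exact_mod_cast hq0
  have hpu : (p : ZMod q) * (p : ZMod q)⁻¹ = 1 := ZMod.coe_mul_inv_eq_one p hpq
  choose θ M hθ hd using fun j => exists_eq_coe_add_toAddCircle q (x j - x k)
  -- Multiplication by `q` kills the residues `M j`, so the injectivity of `q • x` makes the offsets
  -- `θ j` distinct.
  have hqd : ∀ j, q • x j = q • x k + q • (θ j : UnitAddCircle) := by
    intro j
    have h := congrArg (fun z => q • z) (hd j)
    simp only [nsmul_sub, nsmul_add, nsmul_toAddCircle, add_zero] at h
    rw [← h]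
    abel
  have hθinj : Function.Injective θ := by
    intro j l hjl
    refine hx ?_
    dsimp only
    rw [hqd j, hqd l, hjl]
  have hk : θ k = 0 := by
    have h := hd k
    rw [sub_self, eq_comm, ← sub_neg_eq_add, sub_eq_zero, ← map_neg] at h
    refine ((coe_eq_toAddCircle_iff ?_).1 h).1
    rw [abs_of_nonneg (hθ k).1]
    exact (hθ k).2
  set Θ : Finset ℝ := (Finset.univ.erase k).image θ with hΘ
  have hcard : Θ.card = m := by
    rw [hΘ, Finset.card_image_of_injective _ hθinj, Finset.card_erase_of_mem (Finset.mem_univ k)]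
    simp
  have hσ : ∀ l : Fin m, ∃ j, j ≠ k ∧ θ j = Θ.orderEmbOfFin hcard l := by
    intro l
    obtain ⟨j, hj, h⟩ := Finset.mem_image.1 (Finset.orderEmbOfFin_mem Θ hcard l)
    exact ⟨j, Finset.ne_of_mem_erase hj, h⟩
  choose σ hσk hσθ using hσ
  have hσsurj : ∀ j, j ≠ k → ∃ l, σ l = j := by
    intro j hj
    have : θ j ∈ Set.range (Θ.orderEmbOfFin hcard) := by
      rw [Finset.range_orderEmbOfFin]
      exact Finset.mem_image_of_mem _ (Finset.mem_erase.2 ⟨hj, Finset.mem_univ _⟩)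
    obtain ⟨l, hl⟩ := this
    exact ⟨l, hθinj (by rw [hσθ, hl])⟩
  -- The letter is the residue `e` for which the rotated `j`-th point, moved by `e p / q`, lies at
  -- offset `θ j` from the rotated `k`-th point. It is unique because `p` is invertible mod `q`.
  set word : (Fin (m + 1) → ZMod q) → Fin m → ZMod q :=
    fun c l => -(M (σ l) + c (σ l) - c k) * (p : ZMod q)⁻¹ with hword
  have hwe : ∀ c l (e : ZMod q), word c l = e ↔ e * p + M (σ l) + c (σ l) - c k = 0 := by
    intro c l e
    rw [hword]
    constructor
    · rintro rfl
      linear_combination (-(M (σ l) + c (σ l) - c k)) * hpu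
    · intro h
      linear_combination (-(p : ZMod q)⁻¹) * h + e * hpu
  have hbase : ∀ c : Fin (m + 1) → ZMod q, ∃ (u v : ℕ → ℝ) (t : ℝ),
      Chains (fun e => {t : ℝ | ((t - e * r : ℝ) : UnitAddCircle) ∈
        sampleSet (fun j => x j + ZMod.toAddCircle (c j))}) u v ∧
      (∀ e : ℕ, {t : ℝ | ((t - (e + q : ℕ) * r : ℝ) : UnitAddCircle) ∈
        sampleSet (fun j => x j + ZMod.toAddCircle (c j))} =
        {t : ℝ | ((t - e * r : ℝ) : UnitAddCircle) ∈
          sampleSet (fun j => x j + ZMod.toAddCircle (c j))}) ∧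
      WalkInv q u v t (walkRun q i m (word c) (0, 0)) ∧
      (LevelAt i r hr (fun j => x j + ZMod.toAddCircle (c j)) k ↔
        u i ≠ v (i + 1) ∧ u (i + 1) = v (i + 2)) := by
    intro c
    set y : Fin (m + 1) → UnitAddCircle := fun j => x j + ZMod.toAddCircle (c j) with hy
    obtain ⟨s, hs⟩ := QuotientAddGroup.mk_surjective (y k)
    change (s : UnitAddCircle) = y k at hs
    obtain ⟨u, v, hu0, hv0, hu, hv, hlev⟩ := RealLift.exists_chains hr hr1
      (⟨s, hs ▸ mem_sampleSet y k⟩ : RealLift (sampleSet y))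
    dsimp only at hu0 hv0
    have hch : Chains (fun e => {t : ℝ | ((t - e * r : ℝ) : UnitAddCircle) ∈ sampleSet y}) u v :=
      ⟨hu0.trans hv0.symm, hu, hv⟩
    -- In an open window of length `1 / q` after `s` every other sample point shows up once, and the
    -- `k`-th point never does, its offset being `0`.
    obtain ⟨t, ht⟩ := hch.exists_walkInv_run (q := q) (i := i) (x₁ := s + 1 / q)
      (fun l => s + Θ.orderEmbOfFin hcard l) (word c) (v 0) (0, 0)
      (fun a b hab => add_lt_add_right ((Θ.orderEmbOfFin hcard).strictMono hab) s)
      (fun l => by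
        rw [hv0, ← hσθ]
        have : θ (σ l) ≠ 0 := fun h => hσk l (hθinj (h.trans hk.symm))
        have := lt_of_le_of_ne (hθ (σ l)).1 this.symm
        linarith)
      (fun l => by
        rw [← hσθ]
        exact add_lt_add_right (hθ (σ l)).2 s)
      (by
        intro e t ht0 ht1
        rw [hv0] at ht0
        have hyj : ∀ j, y j = ((t - e * r : ℝ) : UnitAddCircle) ↔
            t = s + θ j ∧ (e : ZMod q) * p + M j + c j - c k = 0 := by
          intro j
          have e1 : ((e * r : ℝ) : UnitAddCircle) = ZMod.toAddCircle ((e * p : ℕ) : ZMod q) := by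
            rw [ZMod.toAddCircle_natCast, hrpq]
            push_cast
            rw [mul_div_assoc]
          have e2 : x j = x k + θ j + ZMod.toAddCircle (M j) := by
            rw [add_assoc, ← hd j]
            abel
          have e3 : |t - (s + θ j)| < 1 / q := by
            rw [abs_lt]
            have := hθ j
            constructor <;> linarith
          rw [show (t = s + θ j ↔ t - (s + θ j) = 0) from sub_eq_zero.symm,
            ← coe_eq_toAddCircle_iff e3, AddCircle.coe_sub, AddCircle.coe_sub, AddCircle.coe_add,
            e1, hs, hy]
          dsimp only
          rw [e2, map_sub, map_add, map_add, Nat.cast_mul]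
          constructor
          · intro h
            rw [sub_eq_iff_eq_add.1 h.symm]
            abel
          · intro h
            rw [sub_eq_iff_eq_add.1 h]
            abel
        change ((t - e * r : ℝ) : UnitAddCircle) ∈ sampleSet y ↔ _
        rw [mem_sampleSet_iff]
        constructor
        · rintro ⟨j, hj⟩
          rw [hyj] at hj
          have hjk : j ≠ k := by
            rintro rfl
            rw [hk, add_zero] at hj
            exact ht0.ne' hj.1
          obtain ⟨l, rfl⟩ := hσsurj j hjk
          exact ⟨l, by rw [← hσθ]; exact hj.1, (hwe c l e).2 hj.2⟩
        · rintro ⟨l, h1, h2⟩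
          exact ⟨σ l, (hyj _).2 ⟨by rw [hσθ]; exact h1, (hwe c l e).1 h2⟩⟩)
      (hch.walkInv_zero hq0)
    refine ⟨u, v, t, hch, ?_, ht, ?_⟩
    · intro e
      ext t
      simp only [Set.mem_ofPred_eq]
      have : (t - e * r : ℝ) = t - (e + q : ℕ) * r + (p : ℤ) := by
        rw [hrpq]
        push_cast
        field_simp
        ring
      rw [this, UnitAddCircle.coe_add_int]
    · have hproj : (⟨y k, mem_sampleSet y k⟩ : sampleSet y) =
          RealLift.proj (⟨s, hs ▸ mem_sampleSet y k⟩ : RealLift (sampleSet y)) :=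
        Subtype.ext hs.symm
      rw [LevelAt, Set.mem_sdiff, hproj, hlev, hlev, not_not]
  refine ⟨word, ?_, ?_, ?_⟩
  · rw [Fintype.bijective_iff_injective_and_card]
    refine ⟨fun c c' h => ?_, ?_⟩
    · rw [Prod.mk.injEq] at h
      ext j
      by_cases hj : j = k
      · rw [hj, h.1]
      · obtain ⟨l, rfl⟩ := hσsurj j hj
        have h1 := (hwe c l _).1 rfl
        have h2 := (hwe c' l _).1 rfl
        rw [← h.2] at h2
        have : c (σ l) = c' (σ l) := by linear_combination h1 - h2 + h.1
        rw [this]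
    · simp [pow_succ']
  · intro c hc
    obtain ⟨u, v, t, hch, -, hw, hlev⟩ := hbase c
    rw [hc] at hw
    exact hlev.2 (hch.level_of_walkInv hw)
  · intro c hc hc'
    obtain ⟨u, v, t, hch, hS, hw, hlev⟩ := hbase c
    rw [hlev]
    exact hch.not_level_of_walkInv hq0 hS hw hc hc'

-- Words that lead to `(i, i + 1)` bound the count from below, words absorbed elsewhere bound it
-- from above. The extra factor `q` comes from the free coordinate `c k`.
open Classical in
theorem abs_sum_levelAt_sub_le {p q : ℕ} [NeZero q] (hpq : p.Coprime q) (i : ℕ) {r : ℝ}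
    (hr : 0 < r) (hr1 : r ≤ 1) (hrpq : r = p / q) {m : ℕ} (x : Fin (m + 1) → UnitAddCircle)
    (hx : Function.Injective fun j => q • x j) (k : Fin (m + 1)) :
    |(∑ c : Fin (m + 1) → ZMod q,
        if LevelAt i r hr (fun j => x j + ZMod.toAddCircle (c j)) k then (1 : ℝ) else 0) -
      (q : ℝ) ^ (m + 1) * walkProb q i (0, 0)| ≤ 2 ^ (2 * i + 3) * q * ((q : ℝ) - 1) ^ m := by
  obtain ⟨word, hbij, hyes, hno⟩ := exists_word hpq i hr hr1 hrpq x hx k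
  have hq : (0 : ℝ) ≤ q := Nat.cast_nonneg q
  have hsum : ∀ f : (Fin m → ZMod q) → ℝ,
      ∑ c : Fin (m + 1) → ZMod q, f (word c) = q * ∑ w, f w := by
    intro f
    rw [hbij.sum_comp (fun z => f z.2), Fintype.sum_prod_type]
    simp [ZMod.card]
  have h1 := mul_le_mul_of_nonneg_left (le_card_walkRun_eq q i m) hq
  have h2 := mul_le_mul_of_nonneg_left (le_card_walkRun_ne q i m) hq
  rw [← hsum] at h1 h2
  have h3 : (∑ c : Fin (m + 1) → ZMod q,
      if walkRun q i m (word c) (0, 0) = (i, i + 1) then (1 : ℝ) else 0) ≤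
      ∑ c : Fin (m + 1) → ZMod q,
        if LevelAt i r hr (fun j => x j + ZMod.toAddCircle (c j)) k then (1 : ℝ) else 0 := by
    refine Finset.sum_le_sum fun c _ => ?_
    by_cases h : walkRun q i m (word c) (0, 0) = (i, i + 1)
    · rw [if_pos h, if_pos (hyes c h)]
    · rw [if_neg h]
      split_ifs <;> simp
  have h4 : (∑ c : Fin (m + 1) → ZMod q, if Absorbed q i (walkRun q i m (word c) (0, 0)) ∧
      walkRun q i m (word c) (0, 0) ≠ (i, i + 1) then (1 : ℝ) else 0) ≤
      (q : ℝ) ^ (m + 1) - ∑ c : Fin (m + 1) → ZMod q,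
        if LevelAt i r hr (fun j => x j + ZMod.toAddCircle (c j)) k then (1 : ℝ) else 0 := by
    have : (q : ℝ) ^ (m + 1) = ∑ c : Fin (m + 1) → ZMod q, (1 : ℝ) := by simp [ZMod.card]
    rw [this, ← Finset.sum_sub_distrib]
    refine Finset.sum_le_sum fun c _ => ?_
    by_cases h : Absorbed q i (walkRun q i m (word c) (0, 0)) ∧
      walkRun q i m (word c) (0, 0) ≠ (i, i + 1)
    · rw [if_pos h, if_neg (hno c h.1 h.2)]
      simp
    · rw [if_neg h]
      split_ifs <;> simp
  rw [pow_succ (q : ℝ) m] at *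
  rw [abs_le]
  constructor <;> linarith

/-! ### Level counts as sums of indicators, and their measurability. -/

/-- The map permutes its periodic points, so these lie in the range of every iterate and
non-periodicity is automatic. -/
theorem lev_eq_ncard (i : ℕ) (X : Finset UnitAddCircle) (r : ℝ) (hr : 0 < r) :
    lev i X r hr = Set.ncard (Set.range (cyclicMap X r hr)^[i] \
      Set.range (cyclicMap X r hr)^[i + 1]) := by
  rw [lev]
  congr 1
  ext x
  refine ⟨fun h => h.2, fun h => ⟨fun hx => h.2 ?_, h⟩⟩
  obtain ⟨y, -, hy⟩ := (Function.bijOn_periodicPts (cyclicMap X r hr)).surjOn.iterate (i + 1) hx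
  exact ⟨y, hy⟩

open Classical in
theorem lev_sampleSet (i : ℕ) {n : ℕ} {x : Fin n → UnitAddCircle} (hx : Function.Injective x)
    (r : ℝ) (hr : 0 < r) :
    (lev i (sampleSet x) r hr : ℝ) = ∑ k, if LevelAt i r hr x k then (1 : ℝ) else 0 := by
  set g : Fin n → sampleSet x := fun k => ⟨x k, mem_sampleSet x k⟩ with hg
  have hginj : Function.Injective g := fun a b h => hx (congrArg Subtype.val h)
  have hgsurj : Function.Surjective g := by
    rintro ⟨y, hy⟩
    obtain ⟨k, rfl⟩ := mem_sampleSet_iff.1 hy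
    exact ⟨k, rfl⟩
  rw [lev_eq_ncard, ← Set.ncard_preimage_of_injective_subset_range hginj
    (by rw [hgsurj.range_eq]; exact Set.subset_univ _), Finset.sum_boole]
  congr 1
  rw [Set.ncard_eq_toFinset_card']
  congr 1
  ext k
  rw [Set.mem_toFinset, Finset.mem_filter, and_iff_right (Finset.mem_univ k)]
  rfl

theorem lev_le_card (i : ℕ) (X : Finset UnitAddCircle) (r : ℝ) (hr : 0 < r) :
    lev i X r hr ≤ X.card := by
  rw [lev_eq_ncard]
  exact (Set.ncard_le_card _).trans (by simp)

theorem lev_sampleSet_le (i : ℕ) {n : ℕ} (x : Fin n → UnitAddCircle) (r : ℝ) (hr : 0 < r) :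
    lev i (sampleSet x) r hr ≤ n := by
  classical
  refine (lev_le_card i _ r hr).trans ?_
  rw [sampleSet]
  exact Finset.card_image_le.trans (by simp)

theorem measurable_cwDist : Measurable fun z : UnitAddCircle × UnitAddCircle => cwDist z.1 z.2 := by
  have h : Measurable fun z : UnitAddCircle => ((AddCircle.measurableEquivIco 1 0 z : _) : ℝ) :=
    measurable_subtype_coe.comp (AddCircle.measurableEquivIco 1 0).measurable
  exact h.comp (measurable_snd.sub measurable_fst)

theorem measurable_cwDist_apply {n : ℕ} (j k : Fin n) :
    Measurable fun x : Fin n → UnitAddCircle => cwDist (x j) (x k) := by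
  have h : Measurable fun x : Fin n → UnitAddCircle => (x j, x k) :=
    (measurable_pi_apply j).prodMk (measurable_pi_apply k)
  exact measurable_cwDist.comp h

/-- In terms of indices, one step of the map is a finite Boolean combination of inequalities between
distances. -/
theorem measurableSet_iterate_cyclicMap_eq {n : ℕ} (r : ℝ) (hr : 0 < r) (m : ℕ) (j k : Fin n) :
    MeasurableSet {x : Fin n → UnitAddCircle |
      (cyclicMap (sampleSet x) r hr)^[m] ⟨x j, mem_sampleSet x j⟩ = ⟨x k, mem_sampleSet x k⟩} := by
  induction m generalizing j with
  | zero =>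
    simp only [Function.iterate_zero, id_eq, Subtype.mk.injEq]
    exact measurableSet_eq_fun (measurable_pi_apply j) (measurable_pi_apply k)
  | succ m ih =>
    have h : {x : Fin n → UnitAddCircle |
        (cyclicMap (sampleSet x) r hr)^[m + 1] ⟨x j, mem_sampleSet x j⟩ =
          ⟨x k, mem_sampleSet x k⟩} =
        ⋃ l : Fin n, ({x | cwDist (x j) (x l) < r} ∩
          ⋂ a : Fin n, ({x | r ≤ cwDist (x j) (x a)} ∪
            {x | cwDist (x j) (x a) ≤ cwDist (x j) (x l)})) ∩
          {x : Fin n → UnitAddCircle | (cyclicMap (sampleSet x) r hr)^[m]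
            ⟨x l, mem_sampleSet x l⟩ = ⟨x k, mem_sampleSet x k⟩} := by
      ext x
      have hstep : ∀ l : Fin n,
          cyclicMap (sampleSet x) r hr ⟨x j, mem_sampleSet x j⟩ = ⟨x l, mem_sampleSet x l⟩ ↔
          cwDist (x j) (x l) < r ∧
            ∀ a, r ≤ cwDist (x j) (x a) ∨ cwDist (x j) (x a) ≤ cwDist (x j) (x l) := by
        intro l
        rw [cyclicMap_eq_iff]
        refine and_congr_right fun _ => ⟨fun h a => ?_, fun h => ?_⟩
        · exact or_iff_not_imp_left.2 fun h' => h ⟨x a, mem_sampleSet x a⟩ (not_le.1 h')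
        · rintro ⟨z, hz⟩ hzr
          obtain ⟨a, rfl⟩ := mem_sampleSet_iff.1 hz
          exact (h a).resolve_left (not_le.2 hzr)
      simp only [Set.mem_ofPred_eq, Set.mem_iUnion, Set.mem_inter_iff, Set.mem_iInter,
        Set.mem_union, Function.iterate_succ_apply, ← hstep]
      constructor
      · intro hx
        obtain ⟨l, hl⟩ := mem_sampleSet_iff.1
          (cyclicMap (sampleSet x) r hr ⟨x j, mem_sampleSet x j⟩).2
        have hl' : cyclicMap (sampleSet x) r hr ⟨x j, mem_sampleSet x j⟩ =
          ⟨x l, mem_sampleSet x l⟩ := Subtype.ext hl.symm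
        exact ⟨l, hl', hl' ▸ hx⟩
      · rintro ⟨l, hl, hx⟩
        rw [hl, hx]
    rw [h]
    refine MeasurableSet.iUnion fun l => MeasurableSet.inter (MeasurableSet.inter
      (measurableSet_lt (measurable_cwDist_apply j l) measurable_const)
      (MeasurableSet.iInter fun a => MeasurableSet.union
        (measurableSet_le measurable_const (measurable_cwDist_apply j a))
        (measurableSet_le (measurable_cwDist_apply j a) (measurable_cwDist_apply j l)))) (ih l)

theorem measurableSet_mem_range_iterate {n : ℕ} (r : ℝ) (hr : 0 < r) (m : ℕ) (k : Fin n) :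
    MeasurableSet {x : Fin n → UnitAddCircle | (⟨x k, mem_sampleSet x k⟩ : sampleSet x) ∈
      Set.range (cyclicMap (sampleSet x) r hr)^[m]} := by
  have h : {x : Fin n → UnitAddCircle | (⟨x k, mem_sampleSet x k⟩ : sampleSet x) ∈
      Set.range (cyclicMap (sampleSet x) r hr)^[m]} = ⋃ j : Fin n, {x : Fin n → UnitAddCircle |
      (cyclicMap (sampleSet x) r hr)^[m] ⟨x j, mem_sampleSet x j⟩ =
        ⟨x k, mem_sampleSet x k⟩} := by
    ext x
    simp only [Set.mem_ofPred_eq, Set.mem_iUnion, Set.mem_range]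
    constructor
    · rintro ⟨⟨y, hy⟩, h⟩
      obtain ⟨j, rfl⟩ := mem_sampleSet_iff.1 hy
      exact ⟨j, h⟩
    · rintro ⟨j, h⟩
      exact ⟨_, h⟩
  rw [h]
  exact MeasurableSet.iUnion fun j => measurableSet_iterate_cyclicMap_eq r hr m j k

theorem measurableSet_levelAt (i : ℕ) {n : ℕ} (r : ℝ) (hr : 0 < r) (k : Fin n) :
    MeasurableSet {x : Fin n → UnitAddCircle | LevelAt i r hr x k} :=
  (measurableSet_mem_range_iterate r hr i k).diff (measurableSet_mem_range_iterate r hr (i + 1) k)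

/-! ### Uniform measure on the circle and generic samples. -/

instance : IsProbabilityMeasure (volume : Measure UnitAddCircle) := ⟨UnitAddCircle.measure_univ⟩

instance (n : ℕ) : IsProbabilityMeasure (volume : Measure (Fin n → UnitAddCircle)) :=
  inferInstanceAs (IsProbabilityMeasure (Measure.pi fun _ : Fin n => volume))

theorem UnitAddCircle.volume_singleton (z : UnitAddCircle) :
    volume ({z} : Set UnitAddCircle) = 0 := by
  have h := AddCircle.volume_closedBall (T := 1) (x := z) 0
  simpa using h

theorem UnitAddCircle.volume_setOf_cwDist_le {a b : ℝ} :
    volume {z : UnitAddCircle | a ≤ cwDist 0 z ∧ cwDist 0 z < b} ≤ ENNReal.ofReal (b - a) := by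
  have hm : Measurable fun z : UnitAddCircle => cwDist 0 z :=
    measurable_cwDist.comp (measurable_const.prodMk measurable_id)
  have hmeas : MeasurableSet {z : UnitAddCircle | a ≤ cwDist 0 z ∧ cwDist 0 z < b} :=
    (measurableSet_le measurable_const hm).inter (measurableSet_lt hm measurable_const)
  rw [AddCircle.add_projection_respects_measure (T := 1) 0 hmeas]
  -- The fundamental domain is `(0, 1]` while distances lie in `[0, 1)`; the point `1` accounts for
  -- the mismatch.
  calc _ ≤ volume (Set.Ico a b ∪ {1} : Set ℝ) := by
        refine measure_mono ?_
        rintro t ⟨⟨h1, h2⟩, h3, h4⟩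
        rw [zero_add] at h4
        rcases h4.lt_or_eq with h5 | h5
        · left
          have h6 : cwDist 0 (t : UnitAddCircle) = t := cwDist_eq_of_coe h3.le h5 (by simp)
          change a ≤ cwDist 0 (t : UnitAddCircle) at h1
          change cwDist 0 (t : UnitAddCircle) < b at h2
          rw [h6] at h1 h2
          exact ⟨h1, h2⟩
        · exact Or.inr h5
    _ ≤ volume (Set.Ico a b) + volume ({1} : Set ℝ) := measure_union_le _ _
    _ = ENNReal.ofReal (b - a) := by simp

theorem cwDist_zero_sub (x y : UnitAddCircle) : cwDist 0 (y - x) = cwDist x y := by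
  simp [cwDist]

theorem measurePreserving_sub_apply {n : ℕ} {j k : Fin n} (hjk : j ≠ k) :
    MeasurePreserving (fun x : Fin n → UnitAddCircle => x k - x j) volume volume := by
  have h1 : iIndepFun (fun (l : Fin n) (x : Fin n → UnitAddCircle) => x l)
      (volume : Measure (Fin n → UnitAddCircle)) :=
    iIndepFun_pi (X := fun _ z => z) fun _ => aemeasurable_id
  have h2 : MeasurePreserving (fun x : Fin n → UnitAddCircle => (x j, x k)) volume
      (volume.prod volume) := by
    refine ⟨by fun_prop, ?_⟩
    rw [(h1.indepFun hjk).map_prod_eq_prod_map_map (measurable_pi_apply j).aemeasurable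
      (measurable_pi_apply k).aemeasurable]
    have h3 : ∀ l : Fin n, Measure.map (fun x : Fin n → UnitAddCircle => x l) volume = volume :=
      fun l => (measurePreserving_eval (fun _ : Fin n => (volume : Measure UnitAddCircle)) l).map_eq
    rw [h3, h3]
  have h3 := (measurePreserving_snd (μ := (volume : Measure UnitAddCircle))
    (ν := (volume : Measure UnitAddCircle))).comp
    ((measurePreserving_prod_neg_add (volume : Measure UnitAddCircle) volume).comp h2)
  have h4 : (fun x : Fin n → UnitAddCircle => x k - x j) =
      Prod.snd ∘ (fun z : UnitAddCircle × UnitAddCircle => (z.1, -z.1 + z.2)) ∘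
        fun x : Fin n → UnitAddCircle => (x j, x k) := by
    funext x
    simp only [Function.comp_apply]
    abel
  rw [h4]
  exact h3

/-- Differences of two sample points are uniform, and the `q`-torsion is finite, hence null. -/
theorem ae_injective_nsmul (n : ℕ) {q : ℕ} (hq : 0 < q) :
    ∀ᵐ x : Fin n → UnitAddCircle, Function.Injective fun j => q • x j := by
  have h : ∀ j k : Fin n, j ≠ k → ∀ᵐ x : Fin n → UnitAddCircle, q • (x k - x j) ≠ 0 := by
    intro j k hjk
    refine (measurePreserving_sub_apply hjk).quasiMeasurePreserving.ae
      (p := fun z : UnitAddCircle => q • z ≠ 0) ?_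
    rw [ae_iff]
    simp only [ne_eq, not_not]
    have hfin : {z : UnitAddCircle | q • z = 0}.Finite := AddCircle.finite_torsion (1 : ℝ) hq
    rw [← Set.biUnion_of_singleton {z : UnitAddCircle | q • z = 0},
      measure_biUnion_null_iff hfin.countable]
    exact fun z _ => UnitAddCircle.volume_singleton z
  have h' : ∀ᵐ x : Fin n → UnitAddCircle, ∀ j k : Fin n, j ≠ k → q • (x k - x j) ≠ 0 := by
    rw [ae_all_iff]
    intro j
    rw [ae_all_iff]
    intro k
    by_cases hjk : j = k
    · simp [hjk]
    · filter_upwards [h j k hjk] with x hx _ using hx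
  filter_upwards [h'] with x hx j k hjk
  by_contra hne
  refine hx j k hne ?_
  rw [nsmul_sub, sub_eq_zero]
  exact hjk.symm

theorem ae_injective (n : ℕ) : ∀ᵐ x : Fin n → UnitAddCircle, Function.Injective x := by
  filter_upwards [ae_injective_nsmul n one_pos] with x hx j k hjk
  exact hx (by simp [hjk])

open Classical in
theorem lev_sampleSet_ae_eq (i n : ℕ) (r : ℝ) (hr : 0 < r) :
    (fun x : Fin n → UnitAddCircle => (lev i (sampleSet x) r hr : ℝ)) =ᵐ[volume]
      fun x => ∑ k, if LevelAt i r hr x k then (1 : ℝ) else 0 := by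
  filter_upwards [ae_injective n] with x hx
  exact lev_sampleSet i hx r hr

theorem aestronglyMeasurable_lev (i n : ℕ) (r : ℝ) (hr : 0 < r) :
    AEStronglyMeasurable (fun x : Fin n → UnitAddCircle => (lev i (sampleSet x) r hr : ℝ))
      volume := by
  classical
  refine AEStronglyMeasurable.congr (Measurable.aestronglyMeasurable ?_)
    (lev_sampleSet_ae_eq i n r hr).symm
  exact Finset.measurable_sum _ fun k _ =>
    Measurable.ite (measurableSet_levelAt i r hr k) measurable_const measurable_const

theorem integrable_lev (i n : ℕ) (r : ℝ) (hr : 0 < r) :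
    Integrable (fun x : Fin n → UnitAddCircle => (lev i (sampleSet x) r hr : ℝ)) volume := by
  refine Integrable.of_bound (aestronglyMeasurable_lev i n r hr) n (ae_of_all _ fun x => ?_)
  rw [Real.norm_natCast]
  exact_mod_cast lev_sampleSet_le i x r hr

/-! ### The expectation for rational `r`. -/

/-- The expected number of points at level `i` in a uniformly random sample of size `n`. -/
noncomputable def meanLev (i n : ℕ) (r : ℝ) (hr : 0 < r) : ℝ :=
  ∫ x : Fin n → UnitAddCircle, (lev i (sampleSet x) r hr : ℝ)

/-- Each translation `T c` preserves the measure, so the expectation equals that of the average over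
all `c`, which is controlled pointwise for almost every sample. -/
theorem abs_meanLev_sub_le {p q : ℕ} [NeZero q] (hpq : p.Coprime q) (i : ℕ) {r : ℝ}
    (hr : 0 < r) (hr1 : r ≤ 1) (hrpq : r = p / q) (m : ℕ) :
    |meanLev i (m + 1) r hr - (m + 1) * walkProb q i (0, 0)| ≤
      (m + 1) * (2 ^ (2 * i + 3) * (1 - 1 / (q : ℝ)) ^ m) := by
  classical
  have hq : (0 : ℝ) < q := by exact_mod_cast NeZero.pos q
  set φ : (Fin (m + 1) → UnitAddCircle) → ℝ := fun x => (lev i (sampleSet x) r hr : ℝ) with hφ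
  set T : (Fin (m + 1) → ZMod q) → Fin (m + 1) → UnitAddCircle :=
    fun c j => ZMod.toAddCircle (c j) with hT
  have hint : ∀ c, Integrable (fun x => φ (x + T c)) volume := fun c =>
    (integrable_lev i (m + 1) r hr).comp_add_right (T c)
  have havg : ∫ x, ∑ c, φ (x + T c) = (q : ℝ) ^ (m + 1) * meanLev i (m + 1) r hr := by
    rw [integral_finsetSum _ fun c _ => hint c]
    simp only [integral_add_right_eq_self]
    simp [ZMod.card, meanLev, hφ]
  have hae : ∀ᵐ x : Fin (m + 1) → UnitAddCircle,
      ‖∑ c, φ (x + T c) - (m + 1) * ((q : ℝ) ^ (m + 1) * walkProb q i (0, 0))‖ ≤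
        (m + 1) * (2 ^ (2 * i + 3) * q * ((q : ℝ) - 1) ^ m) := by
    filter_upwards [ae_injective_nsmul (m + 1) (NeZero.pos q)] with x hx
    have h1 : ∀ c, φ (x + T c) = ∑ k, if LevelAt i r hr (fun j => x j + ZMod.toAddCircle (c j)) k
        then (1 : ℝ) else 0 := by
      intro c
      refine lev_sampleSet i (x := fun j => x j + ZMod.toAddCircle (c j)) ?_ r hr
      intro j l hjl
      have h2 := congrArg (fun z => q • z) hjl
      simp only [nsmul_add, nsmul_toAddCircle, add_zero] at h2
      exact hx h2
    have h2 : ∑ c, φ (x + T c) - (m + 1) * ((q : ℝ) ^ (m + 1) * walkProb q i (0, 0)) =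
        ∑ k, ((∑ c : Fin (m + 1) → ZMod q, if LevelAt i r hr (fun j => x j + ZMod.toAddCircle (c j)) k
          then (1 : ℝ) else 0) - (q : ℝ) ^ (m + 1) * walkProb q i (0, 0)) := by
      rw [Finset.sum_sub_distrib, Finset.sum_comm, Finset.sum_congr rfl fun c _ => h1 c]
      simp
    rw [h2, Real.norm_eq_abs]
    refine (Finset.abs_sum_le_sum_abs _ _).trans ((Finset.sum_le_sum fun k _ =>
      abs_sum_levelAt_sub_le hpq i hr hr1 hrpq x hx k).trans (le_of_eq ?_))
    simp
  have hnorm := norm_integral_le_of_norm_le_const hae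
  rw [integral_sub (integrable_finsetSum _ fun c _ => hint c) (integrable_const _), havg,
    integral_const, Real.norm_eq_abs] at hnorm
  simp only [probReal_univ, smul_eq_mul, mul_one, one_mul] at hnorm
  have hqp : (0 : ℝ) < (q : ℝ) ^ (m + 1) := by positivity
  refine le_of_mul_le_mul_left (a := (q : ℝ) ^ (m + 1)) ?_ hqp
  calc (q : ℝ) ^ (m + 1) * |meanLev i (m + 1) r hr - (m + 1) * walkProb q i (0, 0)|
      = |(q : ℝ) ^ (m + 1) * meanLev i (m + 1) r hr -
        (m + 1) * ((q : ℝ) ^ (m + 1) * walkProb q i (0, 0))| := by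
        rw [← abs_of_pos hqp, ← abs_mul, abs_of_pos hqp]
        congr 1
        ring
    _ ≤ (m + 1) * (2 ^ (2 * i + 3) * q * ((q : ℝ) - 1) ^ m) := hnorm
    _ = (q : ℝ) ^ (m + 1) * ((m + 1) * (2 ^ (2 * i + 3) * (1 - 1 / (q : ℝ)) ^ m)) := by
        have : (q : ℝ) - 1 = q * (1 - 1 / q) := by field_simp
        rw [this, mul_pow, pow_succ]
        ring

/-! ### Dependence of the expectation on `r`. -/

/-- Each application adds to the difference of the ranges at most the images of the points where `f`
and `g` differ. -/
theorem ncard_range_iterate_diff_le {α : Type*} [Finite α] (f g : α → α) (i : ℕ) :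
    (Set.range f^[i] \ Set.range g^[i]).ncard ≤ i * {x | f x ≠ g x}.ncard := by
  induction i with
  | zero => simp
  | succ i ih =>
    have hsub : Set.range f^[i + 1] \ Set.range g^[i + 1] ⊆
        f '' (Set.range f^[i] \ Set.range g^[i]) ∪ f '' {x | f x ≠ g x} := by
      rintro y ⟨⟨x, rfl⟩, hy⟩
      rw [Function.iterate_succ_apply'] at hy ⊢
      by_cases h1 : f^[i] x ∈ Set.range g^[i]
      · refine Or.inr ⟨_, fun h2 => hy ?_, rfl⟩
        obtain ⟨z, hz⟩ := h1
        exact ⟨z, by rw [Function.iterate_succ_apply', hz, h2]⟩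
      · exact Or.inl ⟨_, ⟨⟨x, rfl⟩, h1⟩, rfl⟩
    calc _ ≤ _ := Set.ncard_le_ncard hsub (Set.toFinite _)
      _ ≤ _ := Set.ncard_union_le _ _
      _ ≤ i * {x | f x ≠ g x}.ncard + {x | f x ≠ g x}.ncard :=
        Nat.add_le_add ((Set.ncard_image_le (Set.toFinite _)).trans ih)
          (Set.ncard_image_le (Set.toFinite _))
      _ = _ := by ring

theorem lev_le_lev_add (i : ℕ) (X : Finset UnitAddCircle) {r r' : ℝ} (hr : 0 < r) (hr' : 0 < r') :
    lev i X r hr ≤ lev i X r' hr' +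
      (2 * i + 1) * {x | cyclicMap X r hr x ≠ cyclicMap X r' hr' x}.ncard := by
  rw [lev_eq_ncard, lev_eq_ncard]
  set f := cyclicMap X r hr
  set g := cyclicMap X r' hr'
  have hsub : Set.range f^[i] \ Set.range f^[i + 1] ⊆
      (Set.range g^[i] \ Set.range g^[i + 1]) ∪ ((Set.range f^[i] \ Set.range g^[i]) ∪
        (Set.range g^[i + 1] \ Set.range f^[i + 1])) := by
    rintro y ⟨h1, h2⟩
    by_cases h3 : y ∈ Set.range g^[i]
    · by_cases h4 : y ∈ Set.range g^[i + 1]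
      · exact Or.inr (Or.inr ⟨h4, h2⟩)
      · exact Or.inl ⟨h3, h4⟩
    · exact Or.inr (Or.inl ⟨h1, h3⟩)
  have h1 := ncard_range_iterate_diff_le f g i
  have h2 := ncard_range_iterate_diff_le g f (i + 1)
  simp only [ne_comm (a := g _)] at h2
  calc _ ≤ _ := Set.ncard_le_ncard hsub (Set.toFinite _)
    _ ≤ _ := (Set.ncard_union_le _ _).trans (Nat.add_le_add_left (Set.ncard_union_le _ _) _)
    _ ≤ _ := Nat.add_le_add_left (Nat.add_le_add h1 h2) _
    _ = _ := by ring

theorem abs_lev_sub_lev_le (i : ℕ) (X : Finset UnitAddCircle) {r r' : ℝ} (hr : 0 < r)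
    (hr' : 0 < r') :
    |(lev i X r hr : ℝ) - lev i X r' hr'| ≤
      (2 * i + 1) * ({x | cyclicMap X r hr x ≠ cyclicMap X r' hr' x}.ncard : ℝ) := by
  have h1 : (lev i X r hr : ℝ) ≤ lev i X r' hr' +
      (2 * i + 1) * ({x | cyclicMap X r hr x ≠ cyclicMap X r' hr' x}.ncard : ℝ) := by
    exact_mod_cast lev_le_lev_add i X hr hr'
  have h2 : (lev i X r' hr' : ℝ) ≤ lev i X r hr +
      (2 * i + 1) * ({x | cyclicMap X r hr x ≠ cyclicMap X r' hr' x}.ncard : ℝ) := by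
    simp only [ne_comm (a := cyclicMap X r hr _)]
    exact_mod_cast lev_le_lev_add i X hr' hr
  rw [abs_le]
  constructor <;> linarith

-- If the image under the larger radius `b` is at distance less than `a`, it is also the image under
-- `a`. So a change forces a pair of distinct sample points at distance in `[a, b)`.
open Classical in
theorem ncard_cyclicMap_ne_le {n : ℕ} (x : Fin n → UnitAddCircle) {a b : ℝ} (ha : 0 < a)
    (hb : 0 < b) (hab : a ≤ b) :
    ({y | cyclicMap (sampleSet x) a ha y ≠ cyclicMap (sampleSet x) b hb y}.ncard : ℝ) ≤
      ∑ j, ∑ k, if j ≠ k ∧ a ≤ cwDist (x j) (x k) ∧ cwDist (x j) (x k) < b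
        then (1 : ℝ) else 0 := by
  set A : Finset (Fin n × Fin n) := Finset.univ.filter fun z =>
    z.1 ≠ z.2 ∧ a ≤ cwDist (x z.1) (x z.2) ∧ cwDist (x z.1) (x z.2) < b with hA
  have hsub : {y | cyclicMap (sampleSet x) a ha y ≠ cyclicMap (sampleSet x) b hb y} ⊆
      (fun z : Fin n × Fin n => (⟨x z.1, mem_sampleSet x z.1⟩ : sampleSet x)) '' A := by
    rintro ⟨y, hy⟩ hne
    obtain ⟨j, rfl⟩ := mem_sampleSet_iff.1 hy
    obtain ⟨k, hk⟩ := mem_sampleSet_iff.1 (cyclicMap (sampleSet x) b hb ⟨x j, hy⟩).2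
    obtain ⟨h1, h2⟩ := cyclicMap_spec (sampleSet x) b hb ⟨x j, hy⟩
    have h3 : a ≤ cwDist (x j) (x k) := by
      by_contra hcon
      refine hne (cyclicMap_eq_iff.2 ⟨?_, fun z hz => h2 z (hz.trans_le hab)⟩)
      rw [← hk]
      exact not_le.1 hcon
    refine ⟨(j, k), ?_, rfl⟩
    rw [hA, Finset.coe_filter]
    refine ⟨Finset.mem_univ _, ?_, h3, by rw [hk]; exact h1⟩
    rintro h
    dsimp only at h
    rw [h, cwDist_self] at h3
    exact absurd h3 (not_le.2 ha)
  have hcard : ({y | cyclicMap (sampleSet x) a ha y ≠ cyclicMap (sampleSet x) b hb y}.ncard) ≤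
      A.card := by
    refine (Set.ncard_le_ncard hsub (Set.toFinite _)).trans ?_
    refine (Set.ncard_image_le (Set.toFinite _)).trans ?_
    rw [Set.ncard_coe_finset]
  refine (Nat.cast_le.2 hcard).trans (le_of_eq ?_)
  rw [hA, ← Fintype.sum_prod_type'
    (f := fun j k => if j ≠ k ∧ a ≤ cwDist (x j) (x k) ∧ cwDist (x j) (x k) < b
        then (1 : ℝ) else 0), Finset.sum_boole]

theorem measurableSet_cwDist_mem {n : ℕ} (a b : ℝ) (j k : Fin n) :
    MeasurableSet {x : Fin n → UnitAddCircle |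
      j ≠ k ∧ a ≤ cwDist (x j) (x k) ∧ cwDist (x j) (x k) < b} :=
  (MeasurableSet.const _).inter ((measurableSet_le measurable_const
    (measurable_cwDist_apply j k)).inter
      (measurableSet_lt (measurable_cwDist_apply j k) measurable_const))

theorem measureReal_cwDist_mem_le {n : ℕ} {a b : ℝ} (hab : a ≤ b) (j k : Fin n) :
    (volume : Measure (Fin n → UnitAddCircle)).real {x : Fin n → UnitAddCircle |
      j ≠ k ∧ a ≤ cwDist (x j) (x k) ∧ cwDist (x j) (x k) < b} ≤ b - a := by
  by_cases hjk : j = k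
  · simp [hjk, hab]
  · refine ENNReal.toReal_le_of_le_ofReal (by linarith) ?_
    have hm : Measurable fun z : UnitAddCircle => cwDist 0 z :=
      measurable_cwDist.comp (measurable_const.prodMk measurable_id)
    have hmeas : MeasurableSet {z : UnitAddCircle | a ≤ cwDist 0 z ∧ cwDist 0 z < b} :=
      (measurableSet_le measurable_const hm).inter (measurableSet_lt hm measurable_const)
    refine le_trans (le_of_eq ?_) UnitAddCircle.volume_setOf_cwDist_le
    rw [← (measurePreserving_sub_apply hjk).measure_preimage hmeas.nullMeasurableSet]
    simp [cwDist_zero_sub, hjk]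

theorem abs_meanLev_sub_meanLev_le (i n : ℕ) {a b : ℝ} (ha : 0 < a) (hb : 0 < b) (hab : a ≤ b) :
    |meanLev i n a ha - meanLev i n b hb| ≤ (2 * i + 1) * (n ^ 2 * (b - a)) := by
  classical
  have hind : ∀ j k : Fin n, (fun x : Fin n → UnitAddCircle =>
      if j ≠ k ∧ a ≤ cwDist (x j) (x k) ∧ cwDist (x j) (x k) < b then (1 : ℝ) else 0) =
      Set.indicator {x : Fin n → UnitAddCircle |
        j ≠ k ∧ a ≤ cwDist (x j) (x k) ∧ cwDist (x j) (x k) < b} 1 := by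
    intro j k
    funext x
    simp [Set.indicator_apply]
  have hint : ∀ j k : Fin n, Integrable (fun x : Fin n → UnitAddCircle =>
      if j ≠ k ∧ a ≤ cwDist (x j) (x k) ∧ cwDist (x j) (x k) < b then (1 : ℝ) else 0) volume := by
    intro j k
    rw [hind]
    exact (integrable_const (1 : ℝ)).indicator (measurableSet_cwDist_mem a b j k)
  rw [meanLev, meanLev, ← integral_sub (integrable_lev i n a ha) (integrable_lev i n b hb),
    ← Real.norm_eq_abs]
  refine (norm_integral_le_of_norm_le (((integrable_finsetSum Finset.univ fun j _ =>
    integrable_finsetSum Finset.univ fun k _ => hint j k)).const_mul (2 * i + 1 : ℝ))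
    (ae_of_all _ fun x => ?_)).trans ?_
  · rw [Real.norm_eq_abs]
    exact (abs_lev_sub_lev_le i (sampleSet x) ha hb).trans
      (mul_le_mul_of_nonneg_left (ncard_cyclicMap_ne_le x ha hb hab) (by positivity))
  · rw [integral_const_mul, integral_finsetSum _ fun j _ =>
      integrable_finsetSum Finset.univ fun k _ => hint j k]
    refine mul_le_mul_of_nonneg_left ?_ (by positivity)
    calc _ = ∑ j : Fin n, ∑ k : Fin n, (volume : Measure (Fin n → UnitAddCircle)).real
          {x : Fin n → UnitAddCircle |
            j ≠ k ∧ a ≤ cwDist (x j) (x k) ∧ cwDist (x j) (x k) < b} := by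
          refine Finset.sum_congr rfl fun j _ => ?_
          rw [integral_finsetSum _ fun k _ => hint j k]
          refine Finset.sum_congr rfl fun k _ => ?_
          rw [hind, integral_indicator_one (measurableSet_cwDist_mem a b j k)]
      _ ≤ ∑ j : Fin n, ∑ k : Fin n, (b - a) :=
          Finset.sum_le_sum fun j _ => Finset.sum_le_sum fun k _ =>
            measureReal_cwDist_mem_le hab j k
      _ = n ^ 2 * (b - a) := by
          simp
          ring

theorem abs_meanLev_sub_meanLev_le_abs (i n : ℕ) {r r' : ℝ} (hr : 0 < r) (hr' : 0 < r') :
    |meanLev i n r hr - meanLev i n r' hr'| ≤ (2 * i + 1) * (n ^ 2 * |r - r'|) := by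
  rcases le_total r r' with h | h
  · rw [abs_sub_comm r r', abs_of_nonneg (sub_nonneg.2 h)]
    exact abs_meanLev_sub_meanLev_le i n hr hr' h
  · rw [abs_of_nonneg (sub_nonneg.2 h), abs_sub_comm]
    exact abs_meanLev_sub_meanLev_le i n hr' hr h

/-! ### The limits for rational and irrational `r`. -/

/-- The error is explicit in `q` because in the irrational case `q` varies with `n`. -/
theorem abs_meanLev_div_sub_le {p q : ℕ} (hq : 0 < q) (hpq : p.Coprime q) (i : ℕ) {r : ℝ}
    (hr : 0 < r) (hr1 : r ≤ 1) (hrpq : r = p / q) {n : ℕ} (hn : 0 < n) :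
    |meanLev i n r hr / n - (boundedCatalan i ((q : ℤ) - 2) : ℝ) / 2 ^ (2 * i + 1)| ≤
      2 ^ (2 * i + 3) * (1 - 1 / (q : ℝ)) ^ (n - 1) := by
  have : NeZero q := ⟨hq.ne'⟩
  obtain ⟨m, rfl⟩ : ∃ m, n = m + 1 := ⟨n - 1, by omega⟩
  have h := abs_meanLev_sub_le hpq i hr hr1 hrpq m
  rw [walkProb_zero hq] at h
  have hm : (0 : ℝ) < (m : ℝ) + 1 := by positivity
  rw [Nat.add_sub_cancel]
  push_cast
  refine le_of_mul_le_mul_left (le_trans (le_of_eq ?_) h) hm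
  conv_lhs => rw [← abs_of_pos hm, ← abs_mul, abs_of_pos hm]
  congr 1
  field_simp

theorem tendsto_meanLev_of_rat {p q : ℕ} (hq : 0 < q) (hpq : p.Coprime q) (i : ℕ) {r : ℝ}
    (hr : 0 < r) (hr1 : r ≤ 1) (hrpq : r = p / q) :
    Tendsto (fun n : ℕ => meanLev i n r hr / n) atTop
      (𝓝 ((boundedCatalan i ((q : ℤ) - 2) : ℝ) / 2 ^ (2 * i + 1))) := by
  have hq1 : (1 : ℝ) ≤ q := by exact_mod_cast hq
  have h0 : (0 : ℝ) ≤ 1 - 1 / q := by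
    rw [sub_nonneg, div_le_one (by linarith)]
    exact hq1
  have h1 : 1 - 1 / (q : ℝ) < 1 := by
    have : (0 : ℝ) < 1 / q := by positivity
    linarith
  have hlim : Tendsto (fun n : ℕ => (2 : ℝ) ^ (2 * i + 3) * (1 - 1 / (q : ℝ)) ^ (n - 1)) atTop
      (𝓝 0) := by
    have := ((tendsto_pow_atTop_nhds_zero_of_lt_one h0 h1).comp
      (tendsto_sub_atTop_nat 1)).const_mul ((2 : ℝ) ^ (2 * i + 3))
    simpa using this
  rw [tendsto_iff_dist_tendsto_zero]
  refine squeeze_zero' (Eventually.of_forall fun _ => dist_nonneg) ?_ hlim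
  filter_upwards [eventually_gt_atTop 0] with n hn
  exact abs_meanLev_div_sub_le hq hpq i hr hr1 hrpq hn

/-- Dirichlet approximations of an irrational number in `(0, 1)`, with large denominators. -/
theorem Irrational.exists_coprime_abs_sub_le {r : ℝ} (hirr : Irrational r) (hr : 0 < r)
    (hr1 : r < 1) (Q : ℕ) :
    ∀ᶠ N : ℕ in atTop, ∃ p q : ℕ, Q ≤ q ∧ q ≤ N ∧ p.Coprime q ∧ 0 < (p : ℝ) / q ∧
      (p : ℝ) / q ≤ 1 ∧ |r - p / q| ≤ 1 / ((N + 1) * q) := by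
  -- All rationals with denominator at most `Q + 1` are at distance at least `ε` from `r`. These
  -- include `0` and `1`, so a closer approximation lies in `(0, 1)` and has a large denominator.
  obtain ⟨ε, hε, hε0⟩ := ((hirr.eventually_forall_le_dist_cast_rat_of_den_le (Q + 1)).filter_mono
    nhdsWithin_le_nhds |>.and (self_mem_nhdsWithin (s := Set.Ioi (0 : ℝ)))).exists
  have hlim : Tendsto (fun N : ℕ => 1 / ((N : ℝ) + 1)) atTop (𝓝 0) :=
    tendsto_one_div_add_atTop_nhds_zero_nat
  filter_upwards [hlim.eventually_lt_const hε0, eventually_gt_atTop 0] with N hN hN0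
  obtain ⟨s, hs, hsN⟩ := Real.exists_rat_abs_sub_le_and_den_le r hN0
  have hden : (1 : ℝ) ≤ s.den := by exact_mod_cast s.pos
  have hlt : |r - s| < ε := by
    refine lt_of_le_of_lt (hs.trans ?_) hN
    refine one_div_le_one_div_of_le (by positivity) ?_
    exact le_mul_of_one_le_right (by positivity) hden
  rw [abs_lt] at hlt
  have hr0 := hε 0 (by simp)
  have hr1' := hε 1 (by simp)
  rw [Real.dist_eq, Rat.cast_zero, sub_zero, abs_of_pos hr] at hr0
  rw [Real.dist_eq, Rat.cast_one, abs_of_neg (by linarith)] at hr1'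
  have hspos : (0 : ℝ) < s := by linarith
  have hs1 : (s : ℝ) < 1 := by linarith
  have hnum : 0 < s.num := Rat.num_pos.2 (by exact_mod_cast hspos)
  have hsd : ((s.num.toNat : ℕ) : ℝ) / (s.den : ℝ) = s := by
    rw [Rat.cast_def s]
    congr 1
    exact_mod_cast Int.toNat_of_nonneg hnum.le
  refine ⟨s.num.toNat, s.den, ?_, hsN, ?_, ?_, ?_, ?_⟩
  · by_contra hcon
    have h := hε s (by omega)
    rw [Real.dist_eq] at h
    exact absurd (abs_lt.2 hlt) (not_lt.2 h)
  · have h := s.reduced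
    rwa [← Int.toNat_of_nonneg hnum.le, Int.natAbs_natCast] at h
  · rwa [hsd]
  · rw [hsd]
    exact hs1.le
  · rwa [hsd]

theorem tendsto_meanLev_of_irrational (i : ℕ) {r : ℝ} (hr : 0 < r) (hr1 : r ≤ 1)
    (hirr : Irrational r) :
    Tendsto (fun n : ℕ => meanLev i n r hr / n) atTop (𝓝 ((catalan i : ℝ) / 2 ^ (2 * i + 1))) := by
  have hr1' : r < 1 := lt_of_le_of_ne hr1 (by simpa using hirr.ne_nat 1)
  rw [Metric.tendsto_atTop']
  intro ε hε
  obtain ⟨K, hK0, hK⟩ : ∃ K : ℕ, 0 < K ∧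
      (2 : ℝ) ^ (2 * i + 3) * Real.exp (-(K / 2 : ℝ)) < ε / 2 := by
    have hlim : Tendsto (fun K : ℕ => (2 : ℝ) ^ (2 * i + 3) * Real.exp (-(K / 2 : ℝ))) atTop
        (𝓝 0) := by
      have := (Real.tendsto_exp_neg_atTop_nhds_zero.comp
        ((tendsto_natCast_atTop_atTop (R := ℝ)).atTop_div_const two_pos)).const_mul
        ((2 : ℝ) ^ (2 * i + 3))
      simpa using this
    obtain ⟨K, h1, h2⟩ := ((hlim.eventually_lt_const (half_pos hε)).and
      (eventually_gt_atTop 0)).exists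
    exact ⟨K, h2, h1⟩
  have hKpos : (0 : ℝ) < K := by exact_mod_cast hK0
  obtain ⟨Q, hQ⟩ := exists_nat_gt ((2 * i + 1) * K / (ε / 2) : ℝ)
  -- Denominators are bounded by `N = n / K`. The summand `i + 2` ensures `i ≤ q - 2`, so the
  -- bounded Catalan number is the full one.
  have hev := (Nat.tendsto_div_const_atTop hK0.ne').eventually
    (hirr.exists_coprime_abs_sub_le hr hr1' (Q + i + 2))
  obtain ⟨n₀, hn₀⟩ := eventually_atTop.1 (hev.and (eventually_ge_atTop 2))
  refine ⟨n₀, fun n hn => ?_⟩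
  obtain ⟨⟨p, q, hqQ, hqN, hpq, hs0, hs1, hs⟩, hn2⟩ := hn₀ n hn.le
  have hq0 : 0 < q := by omega
  have hqpos : (0 : ℝ) < q := by exact_mod_cast hq0
  have hnpos : (0 : ℝ) < n := by exact_mod_cast (by omega : 0 < n)
  have hqn : (q : ℝ) * K ≤ n := by
    exact_mod_cast (Nat.mul_le_mul_right K hqN).trans (Nat.div_mul_le_self n K)
  have hnK : (n : ℝ) ≤ K * ((n / K : ℕ) + 1) := by
    exact_mod_cast (Nat.lt_mul_div_succ n hK0).le
  have h1 : |meanLev i n r hr / n - meanLev i n (p / q) hs0 / n| < ε / 2 := by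
    rw [← sub_div, abs_div, abs_of_pos hnpos]
    have h2 := abs_meanLev_sub_meanLev_le_abs i n hr hs0
    have h3 : (n : ℝ) * |r - p / q| ≤ K / q := by
      calc (n : ℝ) * |r - p / q| ≤ (K * ((n / K : ℕ) + 1)) * (1 / (((n / K : ℕ) + 1) * q)) :=
            mul_le_mul hnK hs (abs_nonneg _) (by positivity)
        _ = K / q := by field_simp
    have h4 : (Q : ℝ) ≤ q := by exact_mod_cast (by omega : Q ≤ q)
    calc _ ≤ (2 * i + 1) * (n ^ 2 * |r - p / q|) / n := by gcongr
      _ = (2 * i + 1) * (n * |r - p / q|) := by field_simp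
      _ ≤ (2 * i + 1) * (K / q) := by gcongr
      _ < ε / 2 := by
        rw [← mul_div_assoc, div_lt_iff₀ hqpos, mul_comm (ε / 2), ← div_lt_iff₀ (half_pos hε)]
        linarith
  have h2 : |meanLev i n (p / q) hs0 / n - (catalan i : ℝ) / 2 ^ (2 * i + 1)| < ε / 2 := by
    have h3 := abs_meanLev_div_sub_le hq0 hpq i hs0 hs1 rfl (show 0 < n by omega)
    rw [boundedCatalan_of_le (by omega)] at h3
    refine lt_of_le_of_lt (h3.trans ?_) hK
    refine mul_le_mul_of_nonneg_left ?_ (by positivity)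
    have hq1 : (1 : ℝ) ≤ q := by exact_mod_cast hq0
    have h4 : (0 : ℝ) ≤ 1 - 1 / q := by
      rw [sub_nonneg, div_le_one hqpos]
      exact hq1
    calc (1 - 1 / (q : ℝ)) ^ (n - 1) ≤ Real.exp (-(1 / q)) ^ (n - 1) :=
          pow_le_pow_left₀ h4 (Real.one_sub_le_exp_neg _) _
      _ = Real.exp (-((n - 1 : ℕ) / q : ℝ)) := by
          rw [← Real.exp_nat_mul]
          congr 1
          ring
      _ ≤ Real.exp (-(K / 2 : ℝ)) := by
          -- For `n ≥ 2`, `n - 1 ≥ n / 2 ≥ q K / 2`.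
          rw [Real.exp_le_exp, neg_le_neg_iff, le_div_iff₀ hqpos, Nat.cast_sub (by omega)]
          have : (2 : ℝ) ≤ n := by exact_mod_cast hn2
          push_cast
          linarith
  rw [Real.dist_eq]
  calc _ ≤ _ := abs_sub_le _ (meanLev i n (p / q) hs0 / n) _
    _ < ε / 2 + ε / 2 := add_lt_add h1 h2
    _ = ε := add_halves ε

theorem theorem4p3 {Ω : Type*} [MeasurableSpace Ω] (P : Measure Ω) [IsProbabilityMeasure P]
    (X : (n : ℕ) → Fin n → Ω → UnitAddCircle)
    (hlaw : ∀ n k, HasLaw (X n k) (volume : Measure UnitAddCircle) P)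
    (hindep : ∀ n, iIndepFun (X n) P)
    (r : ℝ) (hr : 0 < r) (hr1 : r ≤ 1) (i : ℕ) :
    (∀ n, Integrable (fun ω => (lev i (sampleSet fun k => X n k ω) r hr : ℝ)) P) ∧
    (Irrational r →
      Tendsto (fun n : ℕ => (∫ ω, (lev i (sampleSet fun k => X n k ω) r hr : ℝ) ∂P) / (n : ℝ))
        atTop (𝓝 ((catalan i : ℝ) / 2 ^ (2 * i + 1)))) ∧
    (∀ p q : ℕ, 0 < q → Nat.Coprime p q → r = (p : ℝ) / (q : ℝ) →
      Tendsto (fun n : ℕ => (∫ ω, (lev i (sampleSet fun k => X n k ω) r hr : ℝ) ∂P) / (n : ℝ))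
        atTop (𝓝 ((boundedCatalan i ((q : ℤ) - 2) : ℝ) / 2 ^ (2 * i + 1)))) := by
  have hX : ∀ n, HasLaw (fun ω k => X n k ω) (volume : Measure (Fin n → UnitAddCircle)) P :=
    fun n => (hindep n).hasLaw_pi (hlaw n)
  have hmean : ∀ n, ∫ ω, (lev i (sampleSet fun k => X n k ω) r hr : ℝ) ∂P = meanLev i n r hr := by
    intro n
    have h := integral_map (hX n).aemeasurable
      (f := fun x : Fin n → UnitAddCircle => (lev i (sampleSet x) r hr : ℝ))
      (by rw [(hX n).map_eq]; exact aestronglyMeasurable_lev i n r hr)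
    rw [(hX n).map_eq] at h
    exact h.symm
  refine ⟨fun n => ?_, fun hirr => ?_, fun p q hq hpq hrpq => ?_⟩
  · have h := integrable_lev i n r hr
    rw [← (hX n).map_eq] at h
    exact h.comp_aemeasurable (hX n).aemeasurable
  · simp only [hmean]
    exact tendsto_meanLev_of_irrational i hr hr1 hirr
  · simp only [hmean]
    exact tendsto_meanLev_of_rat hq hpq i hr hr1 hrpq
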